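/- Let $a<b$ be real numbers, let $y:[a,b]\to\mathbb{R}$ be a Lipschitz function, and let $\gamma(t)=t+i\,y(t)$, $t\in[a,b]$, be the parametrization of its graph (a Lipschitz graph in $\mathbb{C}$, also denoted by $\gamma$). Integrals with respect to arc length on $\gamma$ are $\int_\gamma h\,ds=\int_a^b h(\gamma(t))\sqrt{1+y'(t)^2}\,dt$. Let $\varphi:\mathbb{C}\to[-\infty,\infty)$ be subharmonic, $\varphi\not\equiv-\infty$. For every $z\in\mathbb{C}$ write $$\nu(\varphi)(z):=\lim_{r\to0^+}\frac{\max_{|\zeta-z|=r}\varphi(\zeta)}{\log r}$$ for the Lelong number of $\varphi$ at $z$. Then, for every $t\in[a,b]$, the limit defining $\nu(\varphi)(\gamma(t))$ exists, and $$\nu(\varphi)(\gamma(t))<1$$ if and only if $e^{-\varphi}$ is integrable with respect to arc length on $\gamma$ near $\gamma(t)$, that is, if and only if there is a neighbourhood $U$ of $\gamma(t)$ in $\mathbb{C}$ with $\int_{\gamma\cap U}e^{-\varphi}\,ds<\infty$ (where $e^{-\varphi}=+\infty$ at the points at which $\varphi=-\infty$). -/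

import Mathlib

open Set Filter Topology MeasureTheory
open scoped NNReal ENNReal

noncomputable section

/-- The mean value `(1 / 2π) ∫_0^{2π} φ (c + r e^{iθ}) dθ` of an extended-real-valued function over a
circle: the integral of the positive part minus the integral of the negative part, divided by `2π`.
(For a function which is bounded above on the circle the first integral is finite, so that the
difference is meaningful, with value in `[-∞, ∞)`.) -/
def circleMean (φ : ℂ → EReal) (c : ℂ) (r : ℝ) : EReal :=
  (((∫⁻ θ in Ioc 0 (2 * Real.pi), (φ (circleMap c r θ)).toENNReal : ℝ≥0∞) : EReal) -
    ((∫⁻ θ in Ioc 0 (2 * Real.pi), (-φ (circleMap c r θ)).toENNReal : ℝ≥0∞) : EReal)) /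
      ((2 * Real.pi : ℝ) : EReal)

/-- Subharmonic functions `φ : ℂ → [-∞, ∞)`: upper semicontinuous functions which are bounded at each
point by their mean values over the circles around that point. The function `-∞` is allowed here. -/
structure IsSubharmonic (φ : ℂ → EReal) : Prop where
  lt_top : ∀ z, φ z < ⊤
  upperSemicontinuous : UpperSemicontinuous φ
  le_circleMean : ∀ (c : ℂ) (r : ℝ), 0 < r → φ c ≤ circleMean φ c r

/-- The quotient `(max_{|ζ - z| = r} φ ζ) / log r`. -/
def lelongQuotient (φ : ℂ → EReal) (z : ℂ) (r : ℝ) : EReal :=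
  (⨆ ζ ∈ Metric.sphere z r, φ ζ) / (Real.log r : EReal)

/-- The Lelong number `ν(φ)(z) = lim_{r → 0+} (max_{|ζ - z| = r} φ ζ) / log r`. -/
def lelongNumber (φ : ℂ → EReal) (z : ℂ) : EReal :=
  limUnder (𝓝[>] (0 : ℝ)) (lelongQuotient φ z)

/-- The parametrization `γ(t) = t + i y(t)` of the graph of `y`. -/
def graphCurve (y : ℝ → ℝ) (t : ℝ) : ℂ := ⟨t, y t⟩

/-- The integral `∫_γ h ds = ∫_a^b h(γ(t)) |γ'(t)| dt`, with `|γ'(t)| = √(1 + y'(t)²)`, of a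
nonnegative function with respect to arc length on the graph `γ` of `y` over `[a, b]`. -/
def arcLintegral (y : ℝ → ℝ) (a b : ℝ) (h : ℂ → ℝ≥0∞) : ℝ≥0∞ :=
  ∫⁻ t in Icc a b, h (graphCurve y t) * ENNReal.ofReal √(1 + (deriv y t) ^ 2)

/-- The nonnegative function `h` is integrable with respect to arc length on the part in some
neighbourhood of `p` of the graph of `y` over `[a, b]`. -/
def LocIntegrableOnGraphAt (y : ℝ → ℝ) (a b : ℝ) (h : ℂ → ℝ≥0∞) (p : ℂ) : Prop :=
  ∃ U ∈ 𝓝 p, arcLintegral y a b (U.indicator h) < ⊤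

end

/-! Let `μ` be the Riesz measure of `φ`, normalised so that `log |·|` has the Dirac mass at `0`. The
mean of `φ` over the circle of radius `e^s` about `z` is increasing and convex in `s`. Its slope
between two radii lies between the masses of the two discs, so the slope at `-∞` is `μ {z}`. The
maximum over the circle dominates the mean and is at most `C + ν log r`, where `ν` is that slope.
Hence the Lelong limit exists and equals `ν` (`RieszApproximation.exists_lelong`).

If `ν < 1`, some disc about `z` has mass less than some `m < 1`. Near `z`, `-φ(ζ)` is at most a
constant plus the potential of `μ` on that disc with kernel `logKernel ρ`. By Jensen's inequality
(`ofReal_exp_integral_le`) the exponential of this potential is controlled by a `μ`-average of `|w -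
ζ|^(-m)`. On the graph `|w - γ(t)| ≥ |Re w - t|`, and `|Re w - t|^(-m)` is integrable in `t`
uniformly in `w`, so Tonelli's theorem concludes. If `ν ≥ 1`, then `φ ≤ C + log |· - z|` near `z`.
Since the graph is Lipschitz, `e^{-φ}` dominates a multiple of `1/|s - t|` along it, which is not
integrable.

The measure `μ` is never constructed. It is replaced by continuous densities `U n` of continuous
functions `G n` tending to `φ` from above, and statements on masses hold for large `n`. No
derivatives are taken: the Laplacian of `logKernel δ` is, up to the factor `2π`, the uniform
probability on the circle of radius `δ` minus the Dirac mass at `0`. Convolving a continuous `g`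
with this kernel therefore gives the explicit density `logDensity`. The Poisson–Jensen formula for
it reduces to the symmetry `circleAverage_logKernel_sub`. -/

/-! ### The truncated logarithmic kernel -/

/-- The kernel `log⁺ (R / |w|)`. -/
noncomputable def logKernel (R : ℝ) (w : ℂ) : ℝ := Real.posLog (R / ‖w‖)

theorem logKernel_nonneg (R : ℝ) (w : ℂ) : 0 ≤ logKernel R w := Real.posLog_nonneg

theorem measurable_logKernel (R : ℝ) : Measurable (logKernel R) := by
  unfold logKernel
  exact Real.continuous_posLog.measurable.comp (by fun_prop)

theorem logKernel_neg (R : ℝ) (w : ℂ) : logKernel R (-w) = logKernel R w := by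
  simp [logKernel]

theorem logKernel_eq_zero {R : ℝ} (hR : 0 < R) {w : ℂ} (hw : R ≤ ‖w‖) : logKernel R w = 0 := by
  rw [logKernel, Real.posLog_eq_zero_iff, abs_of_nonneg (by positivity)]
  exact div_le_one_of_le₀ hw (norm_nonneg _)

theorem logKernel_eq_log {R : ℝ} (hR : 0 < R) {w : ℂ} (hw0 : w ≠ 0) (hw : ‖w‖ ≤ R) :
    logKernel R w = Real.log R - Real.log ‖w‖ := by
  have h0 : 0 < ‖w‖ := norm_pos_iff.2 hw0
  rw [logKernel, Real.posLog_eq_log, Real.log_div hR.ne' h0.ne']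
  rw [abs_of_nonneg (by positivity)]
  exact (one_le_div h0).2 hw

theorem logKernel_eq {R : ℝ} (hR : 0 < R) {w : ℂ} (hw0 : w ≠ 0) :
    logKernel R w = (Real.log R + Real.posLog (R⁻¹ * ‖w‖)) - Real.log ‖w‖ := by
  have h0 : 0 < ‖w‖ := norm_pos_iff.2 hw0
  have := Real.posLog_sub_posLog_inv (x := R / ‖w‖)
  rw [inv_div, Real.log_div hR.ne' h0.ne', div_eq_inv_mul ‖w‖] at this
  rw [logKernel]
  linarith

theorem logKernel_mono {r R : ℝ} (hr : 0 ≤ r) (h : r ≤ R) (w : ℂ) :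
    logKernel r w ≤ logKernel R w :=
  Real.posLog_le_posLog (by positivity) (by gcongr)

theorem integrable_logKernel {R : ℝ} (hR : 0 < R) : Integrable (logKernel R) := by
  have key : IntegrableOn (fun y : ℝ => y ^ (Module.finrank ℝ ℂ - 1) • Real.posLog (R / y))
      (Ioi 0) := by
    have hm : Measurable (fun y : ℝ => y ^ (Module.finrank ℝ ℂ - 1) • Real.posLog (R / y)) :=
      (measurable_id.pow_const _).smul (Real.continuous_posLog.measurable.comp (by fun_prop))
    have hc : IntegrableOn (fun _ : ℝ => R) (Ioc 0 R) :=
      integrableOn_const (by simp)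
    have hi : Integrable ((Ioc 0 R).indicator (fun _ : ℝ => R)) :=
      (integrable_indicator_iff measurableSet_Ioc).2 hc
    refine Integrable.mono' hi.integrableOn hm.aestronglyMeasurable ?_
    filter_upwards [ae_restrict_mem measurableSet_Ioi] with y hy
    have hy : 0 < y := hy
    simp only [Complex.finrank_real_complex, Nat.add_one_sub_one, pow_one, smul_eq_mul, norm_mul,
      Real.norm_eq_abs, abs_of_pos hy, abs_of_nonneg Real.posLog_nonneg]
    by_cases hyR : y ≤ R
    · have hmem : y ∈ Ioc 0 R := ⟨hy, hyR⟩
      rw [indicator_of_mem hmem]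
      have h1 : 1 ≤ R / y := (one_le_div hy).2 hyR
      rw [Real.posLog_eq_log (by rwa [abs_of_nonneg (by positivity)])]
      have := Real.log_le_self (x := R / y) (by positivity)
      calc y * Real.log (R / y) ≤ y * (R / y) := by gcongr
        _ = R := by field_simp
    · rw [indicator_of_notMem (fun h => hyR h.2)]
      rw [(Real.posLog_eq_zero_iff _).2, mul_zero]
      rw [abs_of_nonneg (by positivity)]
      exact div_le_one_of_le₀ (not_le.1 hyR).le hy.le
  exact (integrable_fun_norm_addHaar (E := ℂ) volume (f := fun y => Real.posLog (R / y))).2 key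

theorem integral_logKernel_pos {R : ℝ} (hR : 0 < R) : 0 < ∫ w, logKernel R w := by
  rw [integral_pos_iff_support_of_nonneg (logKernel_nonneg R) (integrable_logKernel hR)]
  have hsub : Metric.ball (0 : ℂ) R \ {0} ⊆ Function.support (logKernel R) := by
    rintro w ⟨hw, hw0⟩
    rw [mem_ball_zero_iff] at hw
    have h0 : 0 < ‖w‖ := norm_pos_iff.2 hw0
    rw [Function.mem_support, logKernel_eq_log hR hw0 hw.le]
    have := Real.log_lt_log h0 hw
    linarith
  refine lt_of_lt_of_le ?_ (measure_mono hsub)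
  rw [measure_sdiff_null (by simp)]
  exact Metric.measure_ball_pos volume _ hR

/-! ### Circle averages -/

theorem circleMap_eq_add (c : ℂ) (R θ : ℝ) : circleMap c R θ = c + circleMap 0 R θ := by
  simp [circleMap]

theorem circleAverage_eq_setIntegral (f : ℂ → ℝ) (c : ℂ) (R : ℝ) :
    Real.circleAverage f c R
      = (2 * Real.pi)⁻¹ * ∫ θ in Ioc 0 (2 * Real.pi), f (circleMap c R θ) := by
  rw [Real.circleAverage, intervalIntegral.integral_of_le Real.two_pi_pos.le, smul_eq_mul]

theorem circleIntegrable_iff_integrableOn (f : ℂ → ℝ) (c : ℂ) (R : ℝ) :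
    CircleIntegrable f c R ↔
      IntegrableOn (fun θ => f (circleMap c R θ)) (Ioc 0 (2 * Real.pi)) := by
  rw [CircleIntegrable, intervalIntegrable_iff_integrableOn_Ioc_of_le Real.two_pi_pos.le]

theorem circleAverage_comp_add (f : ℂ → ℝ) (c d : ℂ) (R : ℝ) :
    Real.circleAverage (fun x => f (c + x)) d R = Real.circleAverage f (c + d) R := by
  simp only [circleAverage_eq_setIntegral]
  congr 3
  ext θ
  rw [circleMap_eq_add d, circleMap_eq_add (c + d), add_assoc]

theorem circleAverage_log_norm {x : ℂ} {R : ℝ} (hR : 0 < R) :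
    Real.circleAverage (fun z => Real.log ‖z‖) x R = Real.log R + Real.posLog (R⁻¹ * ‖x‖) := by
  simpa using circleAverage_log_norm_sub_const_eq_log_radius_add_posLog (a := 0) (c := x) hR.ne'

theorem circleIntegrable_log_norm (x : ℂ) (R : ℝ) :
    CircleIntegrable (fun z => Real.log ‖z‖) x R := by
  simpa using circleIntegrable_log_norm_sub_const (a := 0) (c := x) R

/-- The mean over a circle of radius `δ` of the means of `log |·|` over circles of radius `R` does
not depend on the order of the two means. -/
theorem circleAverage_circleAverage_log_comm (x : ℂ) {δ R : ℝ} (hδ : 0 < δ) (hR : 0 < R) :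
    Real.circleAverage (fun y => Real.log R + Real.posLog (R⁻¹ * ‖y‖)) x δ =
      Real.circleAverage (fun y => Real.log δ + Real.posLog (δ⁻¹ * ‖y‖)) x R := by
  have h1 : ∀ y, Real.log R + Real.posLog (R⁻¹ * ‖y‖)
      = (2 * Real.pi)⁻¹ * ∫ η in Ioc 0 (2 * Real.pi), Real.log ‖circleMap y R η‖ := fun y => by
    rw [← circleAverage_log_norm hR, circleAverage_eq_setIntegral]
  have h2 : ∀ y, Real.log δ + Real.posLog (δ⁻¹ * ‖y‖)
      = (2 * Real.pi)⁻¹ * ∫ η in Ioc 0 (2 * Real.pi), Real.log ‖circleMap y δ η‖ := fun y => by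
    rw [← circleAverage_log_norm hδ, circleAverage_eq_setIntegral]
  simp only [circleAverage_eq_setIntegral]
  simp_rw [h1, h2, integral_const_mul]
  congr 2
  have hsymm : ∀ θ η, circleMap (circleMap x δ θ) R η = circleMap (circleMap x R η) δ θ :=
    fun θ η => by simp only [circleMap]; ring
  rw [integral_integral_swap]
  · simp_rw [hsymm]
  · have hmeas : Measurable (fun p : ℝ × ℝ => Real.log ‖circleMap (circleMap x δ p.1) R p.2‖) := by
      apply Real.measurable_log.comp
      apply Continuous.measurable
      unfold circleMap
      fun_prop
    refine (integrable_prod_iff hmeas.aestronglyMeasurable).2 ⟨?_, ?_⟩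
    · filter_upwards with θ
      exact (circleIntegrable_iff_integrableOn _ _ _).1 (circleIntegrable_log_norm _ R)
    · have hb : ∀ t : ℝ, ‖Real.log t‖ = 2 * Real.posLog t - Real.log t := fun t => by
        have := Real.half_mul_log_add_log_abs (x := t)
        rw [Real.norm_eq_abs]; linarith
      have hpos : ∀ θ, IntegrableOn (fun η => Real.posLog ‖circleMap (circleMap x δ θ) R η‖)
          (Ioc 0 (2 * Real.pi)) := fun θ => by
        apply Continuous.integrableOn_Ioc
        exact Real.continuous_posLog.comp (by unfold circleMap; fun_prop)
      have heq : (fun θ => ∫ η in Ioc 0 (2 * Real.pi),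
          ‖Real.log ‖circleMap (circleMap x δ θ) R η‖‖) =
          fun θ => 2 * (∫ η in (0 : ℝ)..(2 * Real.pi),
            Real.posLog ‖circleMap (circleMap x δ θ) R η‖)
            - (2 * Real.pi) * (Real.log R + Real.posLog (R⁻¹ * ‖circleMap x δ θ‖)) := by
        ext θ
        simp_rw [hb]
        rw [integral_sub ((hpos θ).const_mul 2)
          ((circleIntegrable_iff_integrableOn _ _ _).1 (circleIntegrable_log_norm _ R)),
          integral_const_mul, h1, intervalIntegral.integral_of_le Real.two_pi_pos.le,
          mul_inv_cancel_left₀ Real.two_pi_pos.ne']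
      rw [heq]
      apply Continuous.integrableOn_Ioc
      have hp := Real.continuous_posLog
      refine ((intervalIntegral.continuous_parametric_intervalIntegral_of_continuous' ?_ _ _).const_mul
        2).sub ?_
      · exact hp.comp (by unfold circleMap; fun_prop)
      · refine (continuous_const.add (hp.comp ?_)).const_mul _
        unfold circleMap; fun_prop

theorem circleIntegrable_logKernel {x : ℂ} {δ R : ℝ} (hδ : 0 < δ) (hR : 0 < R) :
    CircleIntegrable (logKernel R) x δ ∧
    Real.circleAverage (logKernel R) x δ =
      Real.circleAverage (fun y => Real.log R + Real.posLog (R⁻¹ * ‖y‖)) x δ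
        - (Real.log δ + Real.posLog (δ⁻¹ * ‖x‖)) := by
  have hc : Continuous (fun y : ℂ => Real.log R + Real.posLog (R⁻¹ * ‖y‖)) :=
    continuous_const.add (Real.continuous_posLog.comp (by fun_prop))
  have hci : CircleIntegrable (fun y : ℂ => Real.log R + Real.posLog (R⁻¹ * ‖y‖)) x δ :=
    hc.continuousOn.circleIntegrable hδ.le
  -- The circle may pass through `0`, where `logKernel_eq` fails; hence equality only off a discrete
  -- set.
  have hae : (fun y => logKernel R y) =ᶠ[Filter.codiscreteWithin (Metric.sphere x |δ|)]
      (fun y : ℂ => Real.log R + Real.posLog (R⁻¹ * ‖y‖)) - (fun y => Real.log ‖y‖) := by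
    have : {z : ℂ | z ≠ 0} ∈ codiscreteWithin (Metric.sphere x |δ|) := by
      apply codiscreteWithin_iff_locallyFiniteComplementWithin.2
      intro z _
      refine ⟨Set.univ, univ_mem, ?_⟩
      apply Set.Subsingleton.finite
      intro z₁ hz₁ z₂ hz₂
      simp_all
    filter_upwards [this] with z hz
    exact logKernel_eq hR hz
  have hsub := hci.sub (circleIntegrable_log_norm x δ)
  refine ⟨hsub.congr_codiscreteWithin hae.symm, ?_⟩
  rw [Real.circleAverage_congr_codiscreteWithin hae hδ.ne',
    Real.circleAverage_sub hci (circleIntegrable_log_norm x δ), circleAverage_log_norm hδ]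

/-- With `σ_R` the uniform probability on the circle of radius `R`, `logKernel R` is `(σ_R - δ_0) *
log |·|`. Both sides are therefore `(σ_R - δ_0) * (σ_δ - δ_0) * log |·|`. -/
theorem circleAverage_logKernel_sub {x : ℂ} (hx : x ≠ 0) {δ R : ℝ} (hδ : 0 < δ) (hR : 0 < R) :
    Real.circleAverage (logKernel R) x δ - logKernel R x =
      Real.circleAverage (logKernel δ) x R - logKernel δ x := by
  rw [(circleIntegrable_logKernel hδ hR).2, (circleIntegrable_logKernel hR hδ).2,
    logKernel_eq hR hx, logKernel_eq hδ hx, circleAverage_circleAverage_log_comm x hδ hR]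
  ring

/-! ### Rotation invariance of the area measure -/

theorem lintegral_comp_rotation (F : ℂ → ℝ≥0∞) (θ : ℝ) :
    ∫⁻ w, F (circleMap 0 1 θ * w) = ∫⁻ w, F w := by
  have h : circleMap 0 1 θ = Circle.exp θ := by simp [circleMap]
  rw [h]
  exact (LinearIsometryEquiv.measurePreserving (rotation (Circle.exp θ))).lintegral_comp_emb
    (rotation (Circle.exp θ)).toHomeomorph.measurableEmbedding F

theorem integral_comp_rotation (F : ℂ → ℝ) (θ : ℝ) :
    ∫ w, F (circleMap 0 1 θ * w) = ∫ w, F w := by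
  have h : circleMap 0 1 θ = Circle.exp θ := by simp [circleMap]
  rw [h]
  exact (LinearIsometryEquiv.measurePreserving (rotation (Circle.exp θ))).integral_comp
    (rotation (Circle.exp θ)).toHomeomorph.measurableEmbedding F

theorem integrable_comp_rotation {F : ℂ → ℝ} (hF : Integrable F) (θ : ℝ) :
    Integrable (fun w => F (circleMap 0 1 θ * w)) := by
  have h : circleMap 0 1 θ = Circle.exp θ := by simp [circleMap]
  rw [h]
  exact ((LinearIsometryEquiv.measurePreserving (rotation (Circle.exp θ))).integrable_comp_emb
    (rotation (Circle.exp θ)).toHomeomorph.measurableEmbedding).2 hF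

theorem circleMap_mul_eq (w : ℂ) (θ : ℝ) :
    circleMap 0 1 θ * w = circleMap 0 ‖w‖ (θ + Complex.arg w) := by
  conv_lhs => rw [← Complex.norm_mul_exp_arg_mul_I w]
  simp only [circleMap]
  push_cast
  rw [add_mul (θ : ℂ), Complex.exp_add]
  ring

theorem lintegral_circleMap_mul (F : ℂ → ℝ≥0∞) (w : ℂ) :
    ∫⁻ θ in Ioc 0 (2 * Real.pi), F (circleMap 0 1 θ * w) =
      ∫⁻ θ in Ioc 0 (2 * Real.pi), F (circleMap 0 ‖w‖ θ) := by
  simp_rw [circleMap_mul_eq]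
  set G : ℝ → ℝ≥0∞ := fun θ => F (circleMap 0 ‖w‖ θ) with hG
  set η := Complex.arg w
  have hper : Function.Periodic G (2 * Real.pi) := fun x => by
    simp only [hG]; rw [periodic_circleMap 0 ‖w‖ x]
  have h1 : ∫⁻ θ in Ioc 0 (2 * Real.pi), G (θ + η) =
      ∫⁻ θ in Ioc (0 + η) (2 * Real.pi + η), G θ := by
    have := (measurePreserving_add_right volume η).setLIntegral_comp_preimage_emb
      (measurableEmbedding_addRight η) G (Ioc (0 + η) (2 * Real.pi + η))
    rw [← this]
    congr 2
    ext; simp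
  rw [h1]
  have hv : ∀ (g : AddSubgroup.zmultiples (2 * Real.pi)) x, G (g +ᵥ x) = G x := by
    rintro ⟨_, n, rfl⟩ x
    rw [AddSubgroup.vadd_def, vadd_eq_add, add_comm]
    exact hper.zsmul n x
  have := (isAddFundamentalDomain_Ioc Real.two_pi_pos (0 + η)).setLIntegral_eq
    (isAddFundamentalDomain_Ioc Real.two_pi_pos 0) G hv
  simpa [add_comm, add_left_comm] using this

/-- Rotations preserve area, so the integral may be averaged over all rotations and the order of
integration exchanged. This takes the place of polar coordinates. -/
theorem lintegral_eq_lintegral_circleMap {F : ℂ → ℝ≥0∞} (hF : Measurable F) :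
    ENNReal.ofReal (2 * Real.pi) * ∫⁻ w, F w =
      ∫⁻ w : ℂ, ∫⁻ θ in Ioc 0 (2 * Real.pi), F (circleMap 0 ‖w‖ θ) := by
  simp_rw [← lintegral_circleMap_mul]
  rw [lintegral_lintegral_swap]
  · simp_rw [lintegral_comp_rotation]
    simp [mul_comm]
  · refine (hF.comp (Continuous.measurable ?_)).aemeasurable
    unfold circleMap
    fun_prop

theorem integrable_prod_rotation {F : ℂ → ℝ} (hF : Measurable F) (hFi : Integrable F) :
    Integrable (Function.uncurry fun (θ : ℝ) (w : ℂ) => F (circleMap 0 1 θ * w))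
      ((volume.restrict (Ioc 0 (2 * Real.pi))).prod volume) := by
  have hm : Measurable (Function.uncurry fun (θ : ℝ) (w : ℂ) => F (circleMap 0 1 θ * w)) := by
    refine hF.comp (Continuous.measurable ?_)
    unfold circleMap
    fun_prop
  refine (integrable_prod_iff hm.aestronglyMeasurable).2 ⟨?_, ?_⟩
  · filter_upwards with θ
    exact integrable_comp_rotation hFi θ
  · have : ∀ θ, ∫ w, ‖F (circleMap 0 1 θ * w)‖ = ∫ w, ‖F w‖ := fun θ =>
      integral_comp_rotation (fun w => ‖F w‖) θ
    simp only [Function.uncurry_apply_pair, this]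
    exact integrable_const _

theorem circleAverage_eq_rotation (F : ℂ → ℝ) (w : ℂ) :
    Real.circleAverage F 0 ‖w‖ =
      (2 * Real.pi)⁻¹ * ∫ θ in Ioc 0 (2 * Real.pi), F (circleMap 0 1 θ * w) := by
  simp_rw [circleMap_mul_eq]
  rw [Real.circleAverage_eq_integral_add (Complex.arg w),
    intervalIntegral.integral_of_le Real.two_pi_pos.le, smul_eq_mul]

theorem integrable_circleAverage_norm {F : ℂ → ℝ} (hF : Measurable F) (hFi : Integrable F) :
    Integrable fun w : ℂ => Real.circleAverage F 0 ‖w‖ := by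
  simp_rw [circleAverage_eq_rotation]
  exact (integrable_prod_rotation hF hFi).integral_prod_right.const_mul _

theorem integral_eq_integral_circleAverage {F : ℂ → ℝ} (hF : Measurable F) (hFi : Integrable F) :
    ∫ w, F w = ∫ w : ℂ, Real.circleAverage F 0 ‖w‖ := by
  simp_rw [circleAverage_eq_rotation]
  rw [integral_const_mul, ← integral_integral_swap (integrable_prod_rotation hF hFi)]
  simp_rw [integral_comp_rotation]
  rw [setIntegral_const, smul_eq_mul, Measure.real, Real.volume_Ioc, sub_zero,
    ENNReal.toReal_ofReal Real.two_pi_pos.le, inv_mul_cancel_left₀ Real.two_pi_pos.ne']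

/-! ### Logarithmic smoothing of continuous functions -/

theorem exists_abs_le_of_continuous {g : ℂ → ℝ} (hg : Continuous g) (ζ : ℂ) (r : ℝ) :
    ∃ C, 0 ≤ C ∧ ∀ w, ‖w - ζ‖ ≤ r → |g w| ≤ C := by
  obtain ⟨C, hC⟩ := (isCompact_closedBall ζ r).exists_bound_of_continuousOn hg.continuousOn
  refine ⟨max C 0, le_max_right _ _, fun w hw => (hC w ?_).trans (le_max_left _ _)⟩
  rwa [Metric.mem_closedBall, dist_eq_norm]

theorem abs_logKernel_mul_le {R : ℝ} (hR : 0 < R) {a C : ℝ} {w : ℂ}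
    (h : ‖w‖ ≤ R → |a| ≤ C) : ‖logKernel R w * a‖ ≤ C * logKernel R w := by
  rw [norm_mul, Real.norm_eq_abs, Real.norm_eq_abs, abs_of_nonneg (logKernel_nonneg _ _), mul_comm]
  by_cases hw : ‖w‖ ≤ R
  · exact mul_le_mul_of_nonneg_right (h hw) (logKernel_nonneg _ _)
  · simp [logKernel_eq_zero hR (not_le.1 hw).le]

theorem integrable_logKernel_mul {g : ℂ → ℝ} (hg : Continuous g) {R : ℝ} (hR : 0 < R) (ζ : ℂ) :
    Integrable fun w => logKernel R w * g (ζ + w) := by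
  obtain ⟨C, -, hC⟩ := exists_abs_le_of_continuous hg ζ R
  refine Integrable.mono' ((integrable_logKernel hR).const_mul C) ?_ ?_
  · exact ((measurable_logKernel R).mul (by fun_prop)).aestronglyMeasurable
  · filter_upwards with w
    exact abs_logKernel_mul_le hR fun hw => hC _ (by simpa using hw)

theorem continuous_integral_logKernel_mul {g : ℂ → ℝ} (hg : Continuous g) {R : ℝ} (hR : 0 < R) :
    Continuous fun ζ => ∫ w, logKernel R w * g (ζ + w) := by
  refine continuous_iff_continuousAt.2 fun ζ₀ => ?_
  obtain ⟨C, -, hC⟩ := exists_abs_le_of_continuous hg ζ₀ (1 + R)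
  refine continuousAt_of_dominated (bound := fun w => C * logKernel R w) ?_ ?_
    ((integrable_logKernel hR).const_mul C) ?_
  · exact Eventually.of_forall fun ζ =>
      ((measurable_logKernel R).mul (by fun_prop)).aestronglyMeasurable
  · filter_upwards [Metric.ball_mem_nhds ζ₀ one_pos] with ζ hζ
    filter_upwards with w
    refine abs_logKernel_mul_le hR fun hw => hC _ ?_
    rw [Metric.mem_ball, dist_eq_norm] at hζ
    calc ‖ζ + w - ζ₀‖ = ‖(ζ - ζ₀) + w‖ := by ring_nf
      _ ≤ ‖ζ - ζ₀‖ + ‖w‖ := norm_add_le _ _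
      _ ≤ 1 + R := by linarith
  · filter_upwards with w
    fun_prop

theorem continuous_circleAverage_center {g : ℂ → ℝ} (hg : Continuous g) (R : ℝ) :
    Continuous fun ζ => Real.circleAverage g ζ R := by
  have h : Continuous fun ζ => ∫ θ in (0 : ℝ)..(2 * Real.pi), g (circleMap ζ R θ) := by
    apply intervalIntegral.continuous_parametric_intervalIntegral_of_continuous'
    unfold circleMap
    fun_prop
  exact h.const_smul (2 * Real.pi)⁻¹

theorem integrable_prod_logKernel_mul {g : ℂ → ℝ} (hg : Continuous g) {R : ℝ} (hR : 0 < R)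
    (ζ : ℂ) (δ : ℝ) :
    Integrable (Function.uncurry fun (w : ℂ) (θ : ℝ) =>
      logKernel R w * g (ζ + w + circleMap 0 δ θ))
      (volume.prod (volume.restrict (Ioc 0 (2 * Real.pi)))) := by
  obtain ⟨C, -, hC⟩ := exists_abs_le_of_continuous hg ζ (R + |δ|)
  refine Integrable.mono' (((integrable_logKernel hR).const_mul C).comp_fst _) ?_ ?_
  · apply Measurable.aestronglyMeasurable
    refine ((measurable_logKernel R).comp measurable_fst).mul (hg.comp ?_).measurable
    unfold circleMap
    fun_prop
  · filter_upwards with p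
    refine abs_logKernel_mul_le hR fun hw => hC _ ?_
    calc ‖ζ + p.1 + circleMap 0 δ p.2 - ζ‖ = ‖p.1 + circleMap 0 δ p.2‖ := by ring_nf
      _ ≤ ‖p.1‖ + ‖circleMap 0 δ p.2‖ := norm_add_le _ _
      _ ≤ R + |δ| := by rw [norm_circleMap_zero]; linarith

/-- For each `θ` the translation `x = w + circleMap 0 δ θ` turns this integrand into that of
`integrable_prod_logKernel_mul`. -/
theorem integrable_prod_logKernel_sub_mul {g : ℂ → ℝ} (hg : Continuous g) {R : ℝ} (hR : 0 < R)
    (ζ : ℂ) (δ : ℝ) :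
    Integrable (Function.uncurry fun (x : ℂ) (θ : ℝ) =>
      logKernel R (x - circleMap 0 δ θ) * g (ζ + x))
      (volume.prod (volume.restrict (Ioc 0 (2 * Real.pi)))) := by
  have h1 := integrable_prod_logKernel_mul hg hR ζ δ
  refine (integrable_prod_iff' ?_).2 ⟨?_, ?_⟩
  · apply Measurable.aestronglyMeasurable
    refine ((measurable_logKernel R).comp (Continuous.measurable ?_)).mul
      (hg.comp (by fun_prop)).measurable
    unfold circleMap
    fun_prop
  · filter_upwards with θ
    have h2 := (integrable_logKernel_mul hg hR (ζ + circleMap 0 δ θ)).comp_sub_right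
      (circleMap 0 δ θ)
    convert h2 using 3
    simp only [Function.uncurry_apply_pair]
    ring_nf
  · convert h1.integral_norm_prod_right using 2 with θ
    simp only [Function.uncurry_apply_pair]
    rw [← integral_sub_right_eq_self (μ := volume)
      (fun x => ‖logKernel R x * g (ζ + x + circleMap 0 δ θ)‖) (circleMap 0 δ θ)]
    congr 1
    ext x
    ring_nf

theorem circleAverage_logKernel_neg (x : ℂ) (R δ : ℝ) :
    Real.circleAverage (logKernel R) (-x) δ =
      (2 * Real.pi)⁻¹ * ∫ θ in Ioc 0 (2 * Real.pi), logKernel R (x - circleMap 0 δ θ) := by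
  rw [circleAverage_eq_setIntegral]
  congr 2
  ext θ
  rw [circleMap_eq_add, ← logKernel_neg]
  congr 1
  ring

theorem integrable_circleAverage_logKernel_mul {g : ℂ → ℝ} (hg : Continuous g) {R : ℝ}
    (hR : 0 < R) (ζ : ℂ) (δ : ℝ) :
    Integrable fun x => Real.circleAverage (logKernel R) (-x) δ * g (ζ + x) := by
  have h := ((integrable_prod_logKernel_sub_mul hg hR ζ δ).integral_prod_left).const_mul
    (2 * Real.pi)⁻¹
  refine h.congr (ae_of_all _ fun x => ?_)
  simp only [Function.uncurry_apply_pair]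
  rw [circleAverage_logKernel_neg, integral_mul_const, mul_assoc]

/-- Moves the circle average from `g` to the kernel, by Fubini and a translation for each angle. -/
theorem integral_logKernel_mul_circleAverage {g : ℂ → ℝ} (hg : Continuous g) {R : ℝ} (hR : 0 < R)
    (ζ : ℂ) (δ : ℝ) :
    ∫ w, logKernel R w * Real.circleAverage g (ζ + w) δ =
      ∫ x, Real.circleAverage (logKernel R) (-x) δ * g (ζ + x) := by
  have h1 : ∀ w, logKernel R w * Real.circleAverage g (ζ + w) δ =
      (2 * Real.pi)⁻¹ * ∫ θ in Ioc 0 (2 * Real.pi),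
        logKernel R w * g (ζ + w + circleMap 0 δ θ) := fun w => by
    rw [circleAverage_eq_setIntegral, integral_const_mul]
    simp_rw [← circleMap_eq_add]
    ring
  have h2 : ∀ x, Real.circleAverage (logKernel R) (-x) δ * g (ζ + x) =
      (2 * Real.pi)⁻¹ * ∫ θ in Ioc 0 (2 * Real.pi),
        logKernel R (x - circleMap 0 δ θ) * g (ζ + x) := fun x => by
    rw [circleAverage_logKernel_neg, integral_mul_const, mul_assoc]
  simp_rw [h1, h2]
  rw [integral_const_mul, integral_const_mul]
  rw [integral_integral_swap (integrable_prod_logKernel_mul hg hR ζ δ),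
    integral_integral_swap (integrable_prod_logKernel_sub_mul hg hR ζ δ)]
  congr 2
  ext θ
  rw [← integral_sub_right_eq_self (μ := volume)
    (fun x => logKernel R x * g (ζ + x + circleMap 0 δ θ)) (circleMap 0 δ θ)]
  congr 1
  ext x
  ring_nf

theorem circleAverage_integral_logKernel_mul {g : ℂ → ℝ} (hg : Continuous g) {R : ℝ} (hR : 0 < R)
    (ζ : ℂ) (δ : ℝ) :
    Real.circleAverage (fun x => ∫ w, logKernel R w * g (x + w)) ζ δ =
      ∫ w, logKernel R w * Real.circleAverage g (ζ + w) δ := by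
  have h1 : ∀ w, logKernel R w * Real.circleAverage g (ζ + w) δ =
      (2 * Real.pi)⁻¹ * ∫ θ in Ioc 0 (2 * Real.pi),
        logKernel R w * g (ζ + w + circleMap 0 δ θ) := fun w => by
    rw [circleAverage_eq_setIntegral, integral_const_mul]
    simp_rw [← circleMap_eq_add]
    ring
  simp_rw [h1]
  rw [integral_const_mul, circleAverage_eq_setIntegral,
    integral_integral_swap (integrable_prod_logKernel_mul hg hR ζ δ)]
  congr 2
  ext θ
  congr 1
  ext w
  rw [circleMap_eq_add]
  ring_nf

/-- The mean of `g` around a point with respect to the probability density proportional to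
`logKernel δ`. -/
noncomputable def logSmoothing (δ : ℝ) (g : ℂ → ℝ) (ζ : ℂ) : ℝ :=
  (∫ w, logKernel δ w)⁻¹ * ∫ w, logKernel δ w * g (ζ + w)

/-- The density of the Riesz measure of `logSmoothing δ g`. -/
noncomputable def logDensity (δ : ℝ) (g : ℂ → ℝ) (w : ℂ) : ℝ :=
  (∫ w, logKernel δ w)⁻¹ * (Real.circleAverage g w δ - g w)

theorem continuous_logSmoothing {g : ℂ → ℝ} (hg : Continuous g) {δ : ℝ} (hδ : 0 < δ) :
    Continuous (logSmoothing δ g) :=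
  (continuous_integral_logKernel_mul hg hδ).const_mul _

theorem continuous_logDensity {g : ℂ → ℝ} (hg : Continuous g) (δ : ℝ) :
    Continuous (logDensity δ g) :=
  ((continuous_circleAverage_center hg δ).sub hg).const_mul _

theorem logDensity_nonneg {g : ℂ → ℝ} {δ : ℝ} (hδ : 0 < δ) {w : ℂ}
    (h : g w ≤ Real.circleAverage g w δ) : 0 ≤ logDensity δ g w :=
  mul_nonneg (inv_nonneg.2 (integral_logKernel_pos hδ).le) (sub_nonneg.2 h)

/-- The Poisson–Jensen formula for `logSmoothing δ g`. -/
theorem integral_logKernel_mul_logDensity {g : ℂ → ℝ} (hg : Continuous g) {δ R : ℝ} (hδ : 0 < δ)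
    (hR : 0 < R) (ζ : ℂ) :
    ∫ w, logKernel R w * logDensity δ g (ζ + w) =
      Real.circleAverage (logSmoothing δ g) ζ R - logSmoothing δ g ζ := by
  have e1 : Real.circleAverage (logSmoothing δ g) ζ R = (∫ w, logKernel δ w)⁻¹ *
      ∫ x, Real.circleAverage (logKernel δ) (-x) R * g (ζ + x) := by
    rw [← integral_logKernel_mul_circleAverage hg hδ, ← circleAverage_integral_logKernel_mul hg hδ]
    unfold logSmoothing
    exact Real.circleAverage_fun_smul (a := (∫ w, logKernel δ w)⁻¹)
  have e2 : ∫ w, logKernel R w * logDensity δ g (ζ + w) = (∫ w, logKernel δ w)⁻¹ *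
      ((∫ x, Real.circleAverage (logKernel R) (-x) δ * g (ζ + x)) -
        ∫ w, logKernel R w * g (ζ + w)) := by
    rw [← integral_logKernel_mul_circleAverage hg hR, ← integral_sub, ← integral_const_mul]
    · congr 1
      ext w
      rw [logDensity]
      ring
    · exact integrable_logKernel_mul (continuous_circleAverage_center hg δ) hR ζ
    · exact integrable_logKernel_mul hg hR ζ
  rw [e1, e2, logSmoothing, ← mul_sub]
  congr 1
  rw [← integral_sub (integrable_circleAverage_logKernel_mul hg hR ζ δ)
    (integrable_logKernel_mul hg hR ζ),
    ← integral_sub (integrable_circleAverage_logKernel_mul hg hδ ζ R)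
    (integrable_logKernel_mul hg hδ ζ)]
  -- Both sides are now integrals against `g (ζ + x)`, with weights that agree for `x ≠ 0` by
  -- `circleAverage_logKernel_sub`.
  refine integral_congr_ae ?_
  have : ∀ᵐ x : ℂ, x ≠ 0 := by simp [ae_iff]
  filter_upwards [this] with x hx
  have := circleAverage_logKernel_sub (neg_ne_zero.2 hx) hδ hR
  rw [logKernel_neg, logKernel_neg] at this
  linear_combination g (ζ + x) * this

/-! ### Means with respect to radial weights -/

/-- A mean with respect to a radial weight is bounded below by a common lower bound of the means
over circles. -/
theorem mul_integral_le_integral_radial {p : ℝ → ℝ} (hp : Measurable p) (hp0 : ∀ r, 0 ≤ p r)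
    {h : ℂ → ℝ} (hh : Measurable h) {ζ : ℂ} {a : ℝ} (hpi : Integrable fun w : ℂ => p ‖w‖)
    (hphi : Integrable fun w : ℂ => p ‖w‖ * h (ζ + w))
    (ha : ∀ r, 0 < r → p r ≠ 0 → a ≤ Real.circleAverage h ζ r) :
    a * ∫ w : ℂ, p ‖w‖ ≤ ∫ w : ℂ, p ‖w‖ * h (ζ + w) := by
  have hm : Measurable fun w : ℂ => p ‖w‖ * h (ζ + w) := by fun_prop
  rw [integral_eq_integral_circleAverage hm hphi, ← integral_const_mul]
  refine integral_mono_ae (hpi.const_mul a) (integrable_circleAverage_norm hm hphi) ?_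
  have : ∀ᵐ x : ℂ, x ≠ 0 := by simp [ae_iff]
  filter_upwards [this] with w hw
  -- The weight is constant on circles about the origin.
  have e : Real.circleAverage (fun w : ℂ => p ‖w‖ * h (ζ + w)) 0 ‖w‖ =
      p ‖w‖ * Real.circleAverage h ζ ‖w‖ := by
    conv_rhs => rw [← add_zero ζ, ← circleAverage_comp_add]
    simp only [circleAverage_eq_setIntegral]
    simp only [norm_circleMap_zero, abs_norm, integral_const_mul]
    ring
  rw [e, mul_comm]
  by_cases h0 : p ‖w‖ = 0
  · simp [h0]
  · exact mul_le_mul_of_nonneg_left (ha _ (norm_pos_iff.2 hw) h0) (hp0 _)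

theorem le_logSmoothing {g : ℂ → ℝ} (hg : Continuous g)
    (hsub : ∀ c r, 0 < r → g c ≤ Real.circleAverage g c r) {δ : ℝ} (hδ : 0 < δ) (ζ : ℂ) :
    g ζ ≤ logSmoothing δ g ζ := by
  have := mul_integral_le_integral_radial (p := fun r => Real.posLog (δ / r))
    (Real.continuous_posLog.measurable.comp (by fun_prop)) (fun r => Real.posLog_nonneg)
    hg.measurable (ζ := ζ) (integrable_logKernel hδ) (integrable_logKernel_mul hg hδ ζ)
    (a := g ζ) (fun r hr _ => hsub ζ r hr)
  rw [logSmoothing, ← div_eq_inv_mul, le_div_iff₀ (integral_logKernel_pos hδ)]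
  exact this

theorem logSmoothing_le {g : ℂ → ℝ} (hg : Continuous g) {δ : ℝ} (hδ : 0 < δ) {ζ : ℂ} {C : ℝ}
    (hC : ∀ w, ‖w - ζ‖ ≤ δ → g w ≤ C) : logSmoothing δ g ζ ≤ C := by
  rw [logSmoothing, ← div_eq_inv_mul, div_le_iff₀ (integral_logKernel_pos hδ), ← integral_const_mul]
  refine integral_mono (integrable_logKernel_mul hg hδ ζ) ((integrable_logKernel hδ).const_mul C) ?_
  intro w
  simp only
  rw [mul_comm C]
  by_cases hw : ‖w‖ ≤ δ
  · exact mul_le_mul_of_nonneg_left (hC _ (by simpa using hw)) (logKernel_nonneg _ _)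
  · simp [logKernel_eq_zero hδ (not_le.1 hw).le]

section

/-! ### Integrability of subharmonic functions -/

variable {φ : ℂ → EReal}

theorem IsSubharmonic.measurable (hφ : IsSubharmonic φ) : Measurable φ :=
  hφ.upperSemicontinuous.measurable

theorem IsSubharmonic.measurable_toReal (hφ : IsSubharmonic φ) :
    Measurable fun z => (φ z).toReal := hφ.measurable.ereal_toReal

theorem IsSubharmonic.coe_toReal (hφ : IsSubharmonic φ) {z : ℂ} (h : φ z ≠ ⊥) :
    ((φ z).toReal : EReal) = φ z := EReal.coe_toReal (hφ.lt_top z).ne h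

theorem IsSubharmonic.exists_le (hφ : IsSubharmonic φ) (z : ℂ) (r : ℝ) :
    ∃ C : ℝ, 0 ≤ C ∧ ∀ w, ‖w - z‖ ≤ r → φ w ≤ C := by
  by_cases hr : 0 ≤ r
  · obtain ⟨m, -, hm⟩ := UpperSemicontinuousOn.exists_isMaxOn
      (Metric.nonempty_closedBall.2 hr : (Metric.closedBall z r).Nonempty)
      (isCompact_closedBall z r) (hφ.upperSemicontinuous.upperSemicontinuousOn _)
    refine ⟨max (φ m).toReal 0, le_max_right _ _, fun w hw => ?_⟩
    have h1 : φ w ≤ φ m := hm (by rwa [Metric.mem_closedBall, dist_eq_norm])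
    refine h1.trans ((EReal.le_coe_toReal (hφ.lt_top m).ne).trans ?_)
    exact EReal.coe_le_coe_iff.2 (le_max_left _ _)
  · exact ⟨0, le_rfl, fun w hw => absurd ((norm_nonneg _).trans hw) hr⟩

/-- The sign of `C` matters because `toReal` sends `⊥` to `0`. -/
theorem toReal_le_of_le {x : EReal} {C : ℝ} (hC : 0 ≤ C) (h : x ≤ C) : x.toReal ≤ C := by
  induction x with
  | bot => simpa
  | coe x => exact EReal.coe_le_coe_iff.1 h
  | top => simp at h

theorem IsSubharmonic.ae_circle_ne_bot (hφ : IsSubharmonic φ) {ζ : ℂ} {r : ℝ}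
    (hB : ∫⁻ θ in Ioc 0 (2 * Real.pi), (-φ (circleMap ζ r θ)).toENNReal ≠ ⊤) :
    ∀ᵐ θ ∂volume.restrict (Ioc 0 (2 * Real.pi)), φ (circleMap ζ r θ) ≠ ⊥ := by
  have hm : Measurable fun θ => (-φ (circleMap ζ r θ)).toENNReal :=
    (hφ.measurable.comp (continuous_circleMap ζ r).measurable).neg.ereal_toENNReal
  filter_upwards [ae_lt_top hm hB] with θ hθ h
  simp [h] at hθ

/-- Passage from `circleMean` to real integrals: once the negative part is integrable, `φ` is finite
almost everywhere on the circle and `toReal` loses nothing. -/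
theorem IsSubharmonic.circleIntegrable_of_lintegral (hφ : IsSubharmonic φ) {ζ : ℂ} {r : ℝ}
    (hB : ∫⁻ θ in Ioc 0 (2 * Real.pi), (-φ (circleMap ζ r θ)).toENNReal ≠ ⊤) :
    CircleIntegrable (fun z => (φ z).toReal) ζ r ∧
    ((∫⁻ θ in Ioc 0 (2 * Real.pi), (φ (circleMap ζ r θ)).toENNReal : ℝ≥0∞) ≠ ⊤) ∧
    2 * Real.pi * Real.circleAverage (fun z => (φ z).toReal) ζ r =
      (∫⁻ θ in Ioc 0 (2 * Real.pi), (φ (circleMap ζ r θ)).toENNReal).toReal -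
      (∫⁻ θ in Ioc 0 (2 * Real.pi), (-φ (circleMap ζ r θ)).toENNReal).toReal := by
  obtain ⟨C, hC0, hC⟩ := hφ.exists_le ζ |r|
  have hne := hφ.ae_circle_ne_bot hB
  have hA : ∫⁻ θ in Ioc 0 (2 * Real.pi), (φ (circleMap ζ r θ)).toENNReal ≠ ⊤ := by
    refine ne_top_of_le_ne_top (b := ∫⁻ θ in Ioc 0 (2 * Real.pi), ENNReal.ofReal C) ?_ ?_
    · simp [ENNReal.mul_eq_top]
    · refine lintegral_mono fun θ => ?_
      exact EReal.toENNReal_le_toENNReal (hC _ (by simp [circleMap]))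
  have e1 : ∀ᵐ θ ∂volume.restrict (Ioc 0 (2 * Real.pi)),
      (φ (circleMap ζ r θ)).toENNReal = ENNReal.ofReal (φ (circleMap ζ r θ)).toReal := by
    filter_upwards with θ
    exact EReal.toENNReal_of_ne_top (hφ.lt_top _).ne
  have e2 : ∀ᵐ θ ∂volume.restrict (Ioc 0 (2 * Real.pi)),
      (-φ (circleMap ζ r θ)).toENNReal = ENNReal.ofReal (-(φ (circleMap ζ r θ)).toReal) := by
    filter_upwards [hne] with θ hθ
    rw [EReal.toENNReal_of_ne_top (by simpa using hθ), EReal.toReal_neg_eq]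
  have hm : Measurable fun θ => (φ (circleMap ζ r θ)).toReal :=
    hφ.measurable_toReal.comp (continuous_circleMap ζ r).measurable
  rw [lintegral_congr_ae e1] at hA ⊢
  rw [lintegral_congr_ae e2] at hB ⊢
  have hint : IntegrableOn (fun θ => (φ (circleMap ζ r θ)).toReal) (Ioc 0 (2 * Real.pi)) := by
    refine ⟨hm.aestronglyMeasurable, ?_⟩
    rw [hasFiniteIntegral_iff_enorm]
    have : ∀ x : ℝ, ‖x‖ₑ ≤ ENNReal.ofReal x + ENNReal.ofReal (-x) := fun x => by
      rw [← ofReal_norm, Real.norm_eq_abs]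
      rcases le_total 0 x with h | h
      · rw [abs_of_nonneg h]; exact le_self_add
      · rw [abs_of_nonpos h]; exact le_add_self
    refine lt_of_le_of_lt (lintegral_mono fun θ => this _) ?_
    rw [lintegral_add_left hm.ennreal_ofReal]
    exact ENNReal.add_lt_top.2 ⟨hA.lt_top, hB.lt_top⟩
  refine ⟨(circleIntegrable_iff_integrableOn _ _ _).2 hint, hA, ?_⟩
  rw [circleAverage_eq_setIntegral, mul_inv_cancel_left₀ Real.two_pi_pos.ne',
    integral_eq_lintegral_pos_part_sub_lintegral_neg_part hint]

theorem IsSubharmonic.lintegral_neg_ne_top (hφ : IsSubharmonic φ) {ζ : ℂ} (hζ : φ ζ ≠ ⊥) {r : ℝ}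
    (hr : 0 < r) :
    ∫⁻ θ in Ioc 0 (2 * Real.pi), (-φ (circleMap ζ r θ)).toENNReal ≠ ⊤ := by
  intro h
  -- An infinite negative part makes the mean `⊥`, since `x - ⊤ = ⊥` in `EReal` for every `x`.
  have h1 := hφ.le_circleMean ζ r hr
  rw [circleMean, h, EReal.coe_ennreal_top, EReal.sub_top,
    EReal.bot_div_of_pos_ne_top (by exact_mod_cast Real.two_pi_pos) (EReal.coe_ne_top _)] at h1
  exact hζ (le_bot_iff.1 h1)

theorem IsSubharmonic.toReal_le_circleAverage (hφ : IsSubharmonic φ) {ζ : ℂ} (hζ : φ ζ ≠ ⊥)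
    {r : ℝ} (hr : 0 < r) : (φ ζ).toReal ≤ Real.circleAverage (fun z => (φ z).toReal) ζ r := by
  have hB := hφ.lintegral_neg_ne_top hζ hr
  obtain ⟨-, hA, heq⟩ := hφ.circleIntegrable_of_lintegral hB
  have h1 := hφ.le_circleMean ζ r hr
  rw [circleMean, ← hφ.coe_toReal hζ, ← EReal.coe_ennreal_toReal hA, ← EReal.coe_ennreal_toReal hB,
    ← EReal.coe_sub, ← EReal.coe_div, EReal.coe_le_coe_iff, ← heq,
    mul_div_cancel_left₀ _ Real.two_pi_pos.ne'] at h1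
  exact h1

/-- The sub-mean value inequality bounds the negative part by the positive part, and the bound
serves all smaller radii too. This uniformity gives integrability over discs. -/
theorem IsSubharmonic.lintegral_neg_le (hφ : IsSubharmonic φ) {ζ : ℂ} (hζ : φ ζ ≠ ⊥) {r C : ℝ}
    (hr : 0 < r) (hC0 : 0 ≤ C) (hC : ∀ w, ‖w - ζ‖ ≤ r → φ w ≤ C) :
    ∫⁻ θ in Ioc 0 (2 * Real.pi), (-φ (circleMap ζ r θ)).toENNReal ≤
      ENNReal.ofReal (2 * Real.pi * (C - (φ ζ).toReal)) := by
  have hB := hφ.lintegral_neg_ne_top hζ hr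
  obtain ⟨-, hA, heq⟩ := hφ.circleIntegrable_of_lintegral hB
  have h1 := hφ.toReal_le_circleAverage hζ hr
  have h2 : (∫⁻ θ in Ioc 0 (2 * Real.pi), (φ (circleMap ζ r θ)).toENNReal).toReal
      ≤ 2 * Real.pi * C := by
    refine ENNReal.toReal_le_of_le_ofReal (by positivity) ?_
    calc _ ≤ ∫⁻ θ in Ioc 0 (2 * Real.pi), ENNReal.ofReal C := lintegral_mono fun θ =>
          EReal.toENNReal_le_toENNReal (hC _ (by simp [circleMap, abs_of_pos hr]))
      _ = ENNReal.ofReal (2 * Real.pi * C) := by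
          rw [setLIntegral_const, Real.volume_Ioc, sub_zero, mul_comm,
            ENNReal.ofReal_mul Real.two_pi_pos.le]
  rw [← ENNReal.ofReal_toReal hB]
  refine ENNReal.ofReal_le_ofReal ?_
  have h3 := mul_le_mul_of_nonneg_left h1 Real.two_pi_pos.le
  linarith

theorem IsSubharmonic.lintegral_ball_neg_lt_top (hφ : IsSubharmonic φ) {ζ : ℂ} (hζ : φ ζ ≠ ⊥)
    (r : ℝ) : ∫⁻ w in Metric.ball ζ r, (-φ w).toENNReal < ⊤ := by
  obtain ⟨C, hC0, hC⟩ := hφ.exists_le ζ r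
  set K := ENNReal.ofReal (2 * Real.pi * (C - (φ ζ).toReal)) with hK
  set F : ℂ → ℝ≥0∞ := (Metric.ball 0 r).indicator fun w => (-φ (ζ + w)).toENNReal with hF
  have hFm : Measurable F := by
    refine Measurable.indicator ?_ measurableSet_ball
    exact (hφ.measurable.comp (measurable_const_add ζ)).neg.ereal_toENNReal
  have e : ∫⁻ w in Metric.ball ζ r, (-φ w).toENNReal = ∫⁻ w, F w := by
    rw [← lintegral_indicator measurableSet_ball, ← lintegral_add_left_eq_self _ ζ]
    congr 1
    ext w
    simp only [hF, indicator, Metric.mem_ball, dist_eq_norm, add_sub_cancel_left, sub_zero]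
  have hle : ∫⁻ w : ℂ, ∫⁻ θ in Ioc 0 (2 * Real.pi), F (circleMap 0 ‖w‖ θ) ≤
      ∫⁻ w in Metric.ball (0 : ℂ) r, K := by
    rw [← lintegral_indicator measurableSet_ball]
    refine lintegral_mono_ae ?_
    have : ∀ᵐ x : ℂ, x ≠ 0 := by simp [ae_iff]
    filter_upwards [this] with w hw
    by_cases hwr : w ∈ Metric.ball (0 : ℂ) r
    · rw [indicator_of_mem hwr]
      refine le_trans (lintegral_mono fun θ => ?_)
        (hφ.lintegral_neg_le hζ (norm_pos_iff.2 hw) hC0 fun v hv => hC v (hv.trans ?_))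
      · rw [circleMap_eq_add ζ]
        exact indicator_le_self _ _ _
      · exact (mem_ball_zero_iff.1 hwr).le
    · rw [indicator_of_notMem hwr, nonpos_iff_eq_zero]
      have : ∀ θ, F (circleMap 0 ‖w‖ θ) = 0 := fun θ => by
        rw [hF, indicator_of_notMem]
        rw [mem_ball_zero_iff] at hwr ⊢
        simpa using hwr
      simp [this]
  rw [e]
  rw [← lintegral_eq_lintegral_circleMap hFm, setLIntegral_const] at hle
  by_contra htop
  rw [not_lt_top_iff.1 htop, ENNReal.mul_top (by simp [Real.pi_pos])] at hle
  exact absurd (top_le_iff.1 hle)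
    (ENNReal.mul_ne_top ENNReal.ofReal_ne_top measure_ball_lt_top.ne)

theorem IsSubharmonic.ae_ne_bot (hφ : IsSubharmonic φ) (hne : ∃ z, φ z ≠ ⊥) :
    ∀ᵐ w, φ w ≠ ⊥ := by
  obtain ⟨ζ, hζ⟩ := hne
  have h : ∀ n : ℕ, ∀ᵐ w, w ∈ Metric.ball ζ n → φ w ≠ ⊥ := fun n => by
    rw [← ae_restrict_iff' measurableSet_ball]
    filter_upwards [ae_lt_top hφ.measurable.neg.ereal_toENNReal
      (hφ.lintegral_ball_neg_lt_top hζ n).ne] with w hw h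
    simp [h] at hw
  filter_upwards [ae_all_iff.2 h] with w hw
  obtain ⟨n, hn⟩ := exists_nat_gt (dist w ζ)
  exact hw n hn

theorem IsSubharmonic.integrableOn_ball (hφ : IsSubharmonic φ) {ζ : ℂ} (hζ : φ ζ ≠ ⊥) (r : ℝ) :
    IntegrableOn (fun z => (φ z).toReal) (Metric.ball ζ r) := by
  refine ⟨hφ.measurable_toReal.aestronglyMeasurable, ?_⟩
  rw [hasFiniteIntegral_iff_enorm]
  obtain ⟨C, hC0, hC⟩ := hφ.exists_le ζ r
  have hle : ∀ᵐ w ∂volume.restrict (Metric.ball ζ r),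
      ‖(φ w).toReal‖ₑ ≤ ENNReal.ofReal C + (-φ w).toENNReal := by
    filter_upwards [ae_restrict_of_ae (hφ.ae_ne_bot ⟨ζ, hζ⟩),
      ae_restrict_mem measurableSet_ball] with w hw hwr
    have hle := hC w (by rw [← dist_eq_norm]; exact (Metric.mem_ball.1 hwr).le)
    rw [← ofReal_norm, Real.norm_eq_abs, EReal.toENNReal_of_ne_top (by simpa using hw),
      EReal.toReal_neg_eq]
    rcases le_total 0 (φ w).toReal with h | h
    · rw [abs_of_nonneg h]
      exact (ENNReal.ofReal_le_ofReal (toReal_le_of_le hC0 hle)).trans le_self_add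
    · rw [abs_of_nonpos h]; exact le_add_self
  refine lt_of_le_of_lt (lintegral_mono_ae hle) ?_
  rw [lintegral_add_left measurable_const, setLIntegral_const]
  exact ENNReal.add_lt_top.2 ⟨ENNReal.mul_lt_top ENNReal.ofReal_lt_top measure_ball_lt_top,
    hφ.lintegral_ball_neg_lt_top hζ r⟩

theorem IsSubharmonic.locallyIntegrable (hφ : IsSubharmonic φ) (hne : ∃ z, φ z ≠ ⊥) :
    LocallyIntegrable fun z => (φ z).toReal := by
  obtain ⟨ζ, hζ⟩ := hne
  intro x
  exact ⟨Metric.ball ζ (dist x ζ + 1), Metric.isOpen_ball.mem_nhds (by simp),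
    hφ.integrableOn_ball hζ _⟩

/-! ### Smoothing by a tent function -/

/-- The tent function of height and radius `δ`. -/
noncomputable def tent (δ : ℝ) (w : ℂ) : ℝ := max (δ - ‖w‖) 0

theorem continuous_tent (δ : ℝ) : Continuous (tent δ) := by unfold tent; fun_prop

theorem tent_nonneg (δ : ℝ) (w : ℂ) : 0 ≤ tent δ w := le_max_right _ _

theorem tent_eq_zero {δ : ℝ} {w : ℂ} (h : δ ≤ ‖w‖) : tent δ w = 0 := max_eq_right (by linarith)

theorem hasCompactSupport_tent (δ : ℝ) : HasCompactSupport (tent δ) :=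
  HasCompactSupport.intro (isCompact_closedBall 0 δ) fun w hw =>
    tent_eq_zero (by rw [mem_closedBall_zero_iff, not_le] at hw; exact hw.le)

theorem integrable_tent (δ : ℝ) : Integrable (tent δ) :=
  (continuous_tent δ).integrable_of_hasCompactSupport (hasCompactSupport_tent δ)

theorem integral_tent_pos {δ : ℝ} (hδ : 0 < δ) : 0 < ∫ w, tent δ w :=
  (continuous_tent δ).integral_pos_of_hasCompactSupport_nonneg_nonzero (hasCompactSupport_tent δ)
    (tent_nonneg δ) (x := 0) (by simp [tent, hδ])

theorem integrable_tent_mul {f : ℂ → ℝ} (hf : LocallyIntegrable f) (δ : ℝ) (ζ : ℂ) :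
    Integrable fun w => tent δ w * f (ζ + w) := by
  have h : Integrable fun x => tent δ (x - ζ) * f x := by
    refine hf.integrable_smul_left_of_hasCompactSupport (g := fun x => tent δ (x - ζ))
      ((continuous_tent δ).comp (by fun_prop)) ?_
    exact (hasCompactSupport_tent δ).comp_homeomorph (Homeomorph.subRight ζ)
  convert h.comp_add_left ζ using 3
  ring_nf

theorem continuous_integral_tent_mul {f : ℂ → ℝ} (hf : LocallyIntegrable f) (δ : ℝ) :
    Continuous fun ζ => ∫ w, tent δ w * f (ζ + w) := by
  have h := (hasCompactSupport_tent δ).continuous_convolution_left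
    (ContinuousLinearMap.mul ℝ ℝ) (continuous_tent δ) hf
  convert h using 2 with ζ
  -- The tent is even, so the integral is a convolution after `w ↦ -w`.
  rw [convolution, ← integral_neg_eq_self]
  simp [tent, sub_eq_add_neg]

/-- The mean of `f` around a point with respect to the probability density proportional to
`tent δ`. -/
noncomputable def tentSmoothing (δ : ℝ) (f : ℂ → ℝ) (ζ : ℂ) : ℝ :=
  (∫ w, tent δ w)⁻¹ * ∫ w, tent δ w * f (ζ + w)

theorem continuous_tentSmoothing {f : ℂ → ℝ} (hf : LocallyIntegrable f) (δ : ℝ) :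
    Continuous (tentSmoothing δ f) := (continuous_integral_tent_mul hf δ).const_mul _

theorem integrable_prod_tent_mul {f : ℂ → ℝ} (hf : LocallyIntegrable f) (hfm : Measurable f)
    (δ r : ℝ) (ζ : ℂ) :
    Integrable (Function.uncurry fun (w : ℂ) (θ : ℝ) => tent δ w * f (circleMap ζ r θ + w))
      (volume.prod (volume.restrict (Ioc 0 (2 * Real.pi)))) := by
  have hm : Measurable (Function.uncurry fun (w : ℂ) (θ : ℝ) =>
      tent δ w * f (circleMap ζ r θ + w)) := by
    refine ((continuous_tent δ).measurable.comp measurable_fst).mul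
      (hfm.comp (Continuous.measurable ?_))
    unfold circleMap
    fun_prop
  refine (integrable_prod_iff' hm.aestronglyMeasurable).2 ⟨?_, ?_⟩
  · filter_upwards with θ
    exact integrable_tent_mul hf δ (circleMap ζ r θ)
  · simp only [Function.uncurry_apply_pair, norm_mul, Real.norm_of_nonneg (tent_nonneg δ _)]
    apply Continuous.integrableOn_Ioc
    have hn : LocallyIntegrable fun z => ‖f z‖ := fun x => (hf x).norm
    exact (continuous_integral_tent_mul hn δ).comp (continuous_circleMap ζ r)

theorem circleAverage_tentSmoothing {f : ℂ → ℝ} (hf : LocallyIntegrable f) (hfm : Measurable f)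
    (δ r : ℝ) (ζ : ℂ) :
    Integrable (fun w => tent δ w * Real.circleAverage f (ζ + w) r) ∧
    Real.circleAverage (tentSmoothing δ f) ζ r =
      (∫ w, tent δ w)⁻¹ * ∫ w, tent δ w * Real.circleAverage f (ζ + w) r := by
  have h := integrable_prod_tent_mul hf hfm δ r ζ
  have e : ∀ w, tent δ w * Real.circleAverage f (ζ + w) r = (2 * Real.pi)⁻¹ *
      ∫ θ in Ioc 0 (2 * Real.pi), tent δ w * f (circleMap ζ r θ + w) := fun w => by
    rw [circleAverage_eq_setIntegral, integral_const_mul]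
    have : ∀ θ, circleMap (ζ + w) r θ = circleMap ζ r θ + w := fun θ => by
      simp only [circleMap]; ring
    simp_rw [this]
    ring
  simp_rw [e]
  refine ⟨h.integral_prod_left.const_mul _, ?_⟩
  rw [integral_const_mul, integral_integral_swap h, circleAverage_eq_setIntegral]
  simp only [tentSmoothing]
  rw [integral_const_mul]
  ring

theorem IsSubharmonic.tentSmoothing_le_circleAverage (hφ : IsSubharmonic φ) (hne : ∃ z, φ z ≠ ⊥)
    {δ : ℝ} (hδ : 0 < δ) (ζ : ℂ) {r : ℝ} (hr : 0 < r) :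
    tentSmoothing δ (fun z => (φ z).toReal) ζ ≤
      Real.circleAverage (tentSmoothing δ fun z => (φ z).toReal) ζ r := by
  have hf := hφ.locallyIntegrable hne
  obtain ⟨hi, he⟩ := circleAverage_tentSmoothing hf hφ.measurable_toReal δ r ζ
  rw [he, tentSmoothing]
  refine mul_le_mul_of_nonneg_left ?_ (inv_nonneg.2 (integral_tent_pos hδ).le)
  refine integral_mono_ae (integrable_tent_mul hf δ ζ) hi ?_
  have : ∀ᵐ w, φ (ζ + w) ≠ ⊥ :=
    (measurePreserving_add_left volume ζ).quasiMeasurePreserving.ae (hφ.ae_ne_bot hne)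
  filter_upwards [this] with w hw
  exact mul_le_mul_of_nonneg_left (hφ.toReal_le_circleAverage hw hr) (tent_nonneg _ _)

theorem IsSubharmonic.le_tentSmoothing (hφ : IsSubharmonic φ) {δ : ℝ} (hδ : 0 < δ) (ζ : ℂ) :
    φ ζ ≤ tentSmoothing δ (fun z => (φ z).toReal) ζ := by
  by_cases hζ : φ ζ = ⊥
  · simp [hζ]
  rw [← hφ.coe_toReal hζ, EReal.coe_le_coe_iff, tentSmoothing, ← div_eq_inv_mul,
    le_div_iff₀ (integral_tent_pos hδ)]
  exact mul_integral_le_integral_radial (p := fun r => max (δ - r) 0) (by fun_prop)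
    (fun r => le_max_right _ _) hφ.measurable_toReal (integrable_tent δ)
    (integrable_tent_mul (hφ.locallyIntegrable ⟨ζ, hζ⟩) δ ζ)
    fun r hr _ => hφ.toReal_le_circleAverage hζ hr

theorem IsSubharmonic.tentSmoothing_le (hφ : IsSubharmonic φ) (hne : ∃ z, φ z ≠ ⊥) {δ : ℝ}
    (hδ : 0 < δ) {ζ : ℂ} {C : ℝ} (hC : ∀ w, ‖w - ζ‖ ≤ δ → φ w ≤ C) :
    tentSmoothing δ (fun z => (φ z).toReal) ζ ≤ C := by
  rw [tentSmoothing, ← div_eq_inv_mul, div_le_iff₀ (integral_tent_pos hδ), ← integral_const_mul]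
  refine integral_mono_ae (integrable_tent_mul (hφ.locallyIntegrable hne) δ ζ)
    ((integrable_tent δ).const_mul C) ?_
  have : ∀ᵐ w, φ (ζ + w) ≠ ⊥ :=
    (measurePreserving_add_left volume ζ).quasiMeasurePreserving.ae (hφ.ae_ne_bot hne)
  filter_upwards [this] with w hw
  rw [mul_comm C]
  by_cases hwδ : ‖w‖ ≤ δ
  · refine mul_le_mul_of_nonneg_left ?_ (tent_nonneg _ _)
    have := hC (ζ + w) (by simpa using hwδ)
    rwa [← hφ.coe_toReal hw, EReal.coe_le_coe_iff] at this
  · simp [tent_eq_zero (not_le.1 hwδ).le]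

/-! ### Regularization -/

/-- A sequence of continuous functions decreasing to `φ` in a weak sense, together with continuous
densities `U n` of the Riesz measures of the functions `G n`. -/
structure RieszApproximation (φ : ℂ → EReal) (G U : ℕ → ℂ → ℝ) : Prop where
  continuous : ∀ n, Continuous (G n)
  continuous_density : ∀ n, Continuous (U n)
  density_nonneg : ∀ n w, 0 ≤ U n w
  le : ∀ n ζ, φ ζ ≤ G n ζ
  le_of_le : ∀ (n : ℕ) ζ (C : ℝ), (∀ w, ‖w - ζ‖ ≤ 2 / (n + 1) → φ w ≤ C) → G n ζ ≤ C
  integral_eq : ∀ n (R : ℝ), 0 < R → ∀ ζ,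
    ∫ w, logKernel R w * U n (ζ + w) = Real.circleAverage (G n) ζ R - G n ζ

/-- The tent smoothing makes the locally integrable `φ` continuous and keeps the sub-mean value
property. The logarithmic smoothing then supplies an explicit nonnegative density. Each has radius
`1 / (n + 1)`, whence `2 / (n + 1)` in the upper bound. -/
theorem IsSubharmonic.exists_rieszApproximation (hφ : IsSubharmonic φ) (hne : ∃ z, φ z ≠ ⊥) :
    ∃ G U, RieszApproximation φ G U := by
  set δ : ℕ → ℝ := fun n => 1 / (n + 1) with hδdef
  have hδ : ∀ n, 0 < δ n := fun n => by positivity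
  set g : ℕ → ℂ → ℝ := fun n => tentSmoothing (δ n) fun z => (φ z).toReal with hg
  have hgc : ∀ n, Continuous (g n) := fun n =>
    continuous_tentSmoothing (hφ.locallyIntegrable hne) _
  have hsub : ∀ n c r, 0 < r → g n c ≤ Real.circleAverage (g n) c r := fun n c r hr =>
    hφ.tentSmoothing_le_circleAverage hne (hδ n) c hr
  refine ⟨fun n => logSmoothing (δ n) (g n), fun n => logDensity (δ n) (g n), ?_, ?_, ?_, ?_, ?_, ?_⟩
  · exact fun n => continuous_logSmoothing (hgc n) (hδ n)
  · exact fun n => continuous_logDensity (hgc n) (δ n)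
  · exact fun n w => logDensity_nonneg (hδ n) (hsub n w _ (hδ n))
  · intro n ζ
    exact (hφ.le_tentSmoothing (hδ n) ζ).trans
      (EReal.coe_le_coe_iff.2 (le_logSmoothing (hgc n) (hsub n) (hδ n) ζ))
  · intro n ζ C hC
    refine logSmoothing_le (hgc n) (hδ n) fun w hw => hφ.tentSmoothing_le hne (hδ n) fun v hv => ?_
    refine hC v ?_
    calc ‖v - ζ‖ = ‖(v - w) + (w - ζ)‖ := by ring_nf
      _ ≤ δ n + δ n := (norm_add_le _ _).trans (add_le_add hv hw)
      _ = 2 / (n + 1) := by simp only [hδdef]; ring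
  · exact fun n R hR ζ => integral_logKernel_mul_logDensity (hgc n) (hδ n) hR ζ

end

/-! ### Riesz masses and circle averages -/

section

variable {φ : ℂ → EReal} {G U : ℕ → ℂ → ℝ}

namespace RieszApproximation

theorem integrable (h : RieszApproximation φ G U) (n : ℕ) {R : ℝ} (hR : 0 < R) (ζ : ℂ) :
    Integrable fun w => logKernel R (w - ζ) * U n w := by
  have := (integrable_logKernel_mul (h.continuous_density n) hR ζ).comp_sub_right ζ
  simpa using this

theorem integral_sub_eq (h : RieszApproximation φ G U) (n : ℕ) {R : ℝ} (hR : 0 < R) (ζ : ℂ) :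
    ∫ w, logKernel R (w - ζ) * U n w = Real.circleAverage (G n) ζ R - G n ζ := by
  rw [← h.integral_eq n R hR ζ, ← integral_sub_right_eq_self (μ := volume)
    (fun w => logKernel R w * U n (ζ + w)) ζ]
  simp

theorem integrableOn_density (h : RieszApproximation φ G U) (n : ℕ) (z : ℂ) (r : ℝ) :
    IntegrableOn (U n) (Metric.ball z r) :=
  ((h.continuous_density n).continuousOn.integrableOn_compact
    (isCompact_closedBall z r)).mono_set Metric.ball_subset_closedBall

theorem circleIntegrable (h : RieszApproximation φ G U) (n : ℕ) (z : ℂ) (r : ℝ) :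
    CircleIntegrable (G n) z r := by
  rw [circleIntegrable_iff_integrableOn]
  exact ((h.continuous n).comp (continuous_circleMap z r)).integrableOn_Ioc

theorem circleAverage_sub_eq (h : RieszApproximation φ G U) (n : ℕ) {r R : ℝ} (hr : 0 < r)
    (hR : 0 < R) (ζ : ℂ) :
    Real.circleAverage (G n) ζ R - Real.circleAverage (G n) ζ r =
      ∫ w, (logKernel R (w - ζ) - logKernel r (w - ζ)) * U n w := by
  simp_rw [sub_mul]
  rw [integral_sub (h.integrable n hR ζ) (h.integrable n hr ζ), h.integral_sub_eq n hR,
    h.integral_sub_eq n hr]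
  ring

theorem circleAverage_mono (h : RieszApproximation φ G U) (n : ℕ) {r R : ℝ} (hr : 0 < r)
    (hrR : r ≤ R) (ζ : ℂ) : Real.circleAverage (G n) ζ r ≤ Real.circleAverage (G n) ζ R := by
  rw [← sub_nonneg, h.circleAverage_sub_eq n hr (hr.trans_le hrR)]
  exact integral_nonneg fun w => mul_nonneg (sub_nonneg.2 (logKernel_mono hr.le hrR _))
    (h.density_nonneg n w)

/-- The difference of the kernels of radii `R` and `r` is nonnegative, and equals `log R - log r` on
the disc of radius `r` off its centre. -/
theorem mul_mass_le (h : RieszApproximation φ G U) (n : ℕ) {r R : ℝ} (hr : 0 < r)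
    (hrR : r ≤ R) (ζ : ℂ) :
    (Real.log R - Real.log r) * ∫ w in Metric.ball ζ r, U n w ≤
      Real.circleAverage (G n) ζ R - Real.circleAverage (G n) ζ r := by
  rw [h.circleAverage_sub_eq n hr (hr.trans_le hrR), ← integral_indicator measurableSet_ball,
    ← integral_const_mul]
  refine integral_mono_ae
    (((integrable_indicator_iff measurableSet_ball).2 (h.integrableOn_density n ζ r)).const_mul _)
    ?_ ?_
  · simp_rw [sub_mul]
    exact (h.integrable n (hr.trans_le hrR) ζ).sub (h.integrable n hr ζ)
  have : ∀ᵐ x : ℂ, x ≠ ζ := by simp [ae_iff]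
  filter_upwards [this] with w hw
  by_cases hwr : w ∈ Metric.ball ζ r
  · rw [indicator_of_mem hwr]
    rw [Metric.mem_ball, dist_eq_norm] at hwr
    rw [logKernel_eq_log (hr.trans_le hrR) (sub_ne_zero.2 hw) (hwr.le.trans hrR),
      logKernel_eq_log hr (sub_ne_zero.2 hw) hwr.le, sub_sub_sub_cancel_right]
  · rw [indicator_of_notMem hwr, mul_zero]
    exact mul_nonneg (sub_nonneg.2 (logKernel_mono hr.le hrR _)) (h.density_nonneg n w)

/-- The same difference vanishes outside the disc of radius `R` and never exceeds `log R - log r`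
off the centre. -/
theorem le_mul_mass (h : RieszApproximation φ G U) (n : ℕ) {r R : ℝ} (hr : 0 < r)
    (hrR : r ≤ R) (ζ : ℂ) :
    Real.circleAverage (G n) ζ R - Real.circleAverage (G n) ζ r ≤
      (Real.log R - Real.log r) * ∫ w in Metric.ball ζ R, U n w := by
  have hR := hr.trans_le hrR
  rw [h.circleAverage_sub_eq n hr hR, ← integral_indicator measurableSet_ball,
    ← integral_const_mul]
  refine integral_mono_ae ?_
    (((integrable_indicator_iff measurableSet_ball).2 (h.integrableOn_density n ζ R)).const_mul _)
    ?_
  · simp_rw [sub_mul]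
    exact (h.integrable n hR ζ).sub (h.integrable n hr ζ)
  have : ∀ᵐ x : ℂ, x ≠ ζ := by simp [ae_iff]
  filter_upwards [this] with w hw
  by_cases hwR : w ∈ Metric.ball ζ R
  · rw [indicator_of_mem hwR]
    rw [Metric.mem_ball, dist_eq_norm] at hwR
    refine mul_le_mul_of_nonneg_right ?_ (h.density_nonneg n w)
    rw [logKernel_eq_log hR (sub_ne_zero.2 hw) hwR.le]
    by_cases hwr : ‖w - ζ‖ ≤ r
    · rw [logKernel_eq_log hr (sub_ne_zero.2 hw) hwr, sub_sub_sub_cancel_right]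
    · rw [logKernel_eq_zero hr (not_le.1 hwr).le]
      have := Real.log_le_log hr (not_le.1 hwr).le
      linarith
  · rw [indicator_of_notMem hwR, mul_zero]
    rw [Metric.mem_ball, dist_eq_norm, not_lt] at hwR
    rw [logKernel_eq_zero hR hwR, logKernel_eq_zero hr (hrR.trans hwR), sub_zero, zero_mul]

/-- The lower bound is `le`; the upper one is semicontinuity of `φ` on the shrinking discs of
`le_of_le`. -/
theorem tendsto (h : RieszApproximation φ G U) (hφ : IsSubharmonic φ) (ζ : ℂ) :
    Tendsto (fun n => (G n ζ : EReal)) atTop (𝓝 (φ ζ)) := by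
  refine tendsto_order.2 ⟨fun c hc => Eventually.of_forall fun n => hc.trans_le (h.le n ζ),
    fun c hc => ?_⟩
  obtain ⟨x, hx1, hx2⟩ := EReal.lt_iff_exists_real_btwn.1 hc
  obtain ⟨ε, hε, hball⟩ := Metric.eventually_nhds_iff.1 (hφ.upperSemicontinuous ζ x hx1)
  have hlim : Tendsto (fun n : ℕ => (2 : ℝ) / (n + 1)) atTop (𝓝 0) :=
    tendsto_const_nhds.div_atTop (tendsto_natCast_atTop_atTop.atTop_add tendsto_const_nhds)
  filter_upwards [hlim.eventually (gt_mem_nhds hε)] with n hn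
  refine lt_of_le_of_lt (EReal.coe_le_coe_iff.2 (h.le_of_le n ζ x fun w hw => ?_)) hx2
  exact (hball (by rw [dist_eq_norm]; exact hw.trans_lt hn)).le

theorem exists_le (h : RieszApproximation φ G U) (hφ : IsSubharmonic φ) (z : ℂ) (r : ℝ) :
    ∃ C : ℝ, 0 ≤ C ∧ ∀ n w, ‖w - z‖ ≤ r → G n w ≤ C := by
  obtain ⟨C, hC0, hC⟩ := hφ.exists_le z (r + 2)
  refine ⟨C, hC0, fun n w hw => h.le_of_le n w C fun v hv => hC v ?_⟩
  have h2 : (2 : ℝ) / (n + 1) ≤ 2 := div_le_self (by norm_num) (by linarith [n.cast_nonneg (α := ℝ)])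
  calc ‖v - z‖ = ‖(v - w) + (w - z)‖ := by ring_nf
    _ ≤ r + 2 := (norm_add_le _ _).trans (by linarith)

/-- Circle means of `G n` increase with the radius, so the mean at radius `R` dominates the tent
mean of `G n`. That dominates the tent mean of `φ`, which is continuous in the centre and
independent of `n`. -/
theorem exists_circleAverage_ge (h : RieszApproximation φ G U) (hφ : IsSubharmonic φ)
    (hne : ∃ z, φ z ≠ ⊥) (z : ℂ) {R : ℝ} (hR : 0 < R) :
    ∃ C : ℝ, ∀ n ζ, ‖ζ - z‖ ≤ R → -C ≤ Real.circleAverage (G n) ζ R := by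
  have hf := hφ.locallyIntegrable hne
  obtain ⟨C, -, hC⟩ := exists_abs_le_of_continuous (continuous_tentSmoothing hf R) z R
  refine ⟨C, fun n ζ hζ => (neg_le_of_abs_le (hC ζ hζ)).trans ?_⟩
  have hG : LocallyIntegrable (G n) := (h.continuous n).locallyIntegrable
  rw [tentSmoothing, ← div_eq_inv_mul, div_le_iff₀ (integral_tent_pos hR)]
  have h1 : ∫ w, tent R w * (φ (ζ + w)).toReal ≤ ∫ w, tent R w * G n (ζ + w) := by
    refine integral_mono_ae (integrable_tent_mul hf R ζ) (integrable_tent_mul hG R ζ) ?_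
    have : ∀ᵐ w, φ (ζ + w) ≠ ⊥ :=
      (measurePreserving_add_left volume ζ).quasiMeasurePreserving.ae (hφ.ae_ne_bot hne)
    filter_upwards [this] with w hw
    refine mul_le_mul_of_nonneg_left ?_ (tent_nonneg _ _)
    rw [← EReal.coe_le_coe_iff, hφ.coe_toReal hw]
    exact h.le n _
  -- Applied to `-G n`, the lower bound for radial means becomes an upper bound.
  have h2 := mul_integral_le_integral_radial (p := fun r => max (R - r) 0) (by fun_prop)
    (fun r => le_max_right _ _) (h := fun w => -G n w) (h.continuous n).neg.measurable
    (ζ := ζ) (integrable_tent R)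
    (by simpa using! (integrable_tent_mul hG R ζ).neg)
    (a := -Real.circleAverage (G n) ζ R) (fun r hr hpr => by
      have hrR : r ≤ R := by
        by_contra hcon
        exact hpr (max_eq_right (by linarith))
      have e : Real.circleAverage (fun w => -G n w) ζ r = -Real.circleAverage (G n) ζ r := by
        simp [circleAverage_eq_setIntegral, integral_neg]
      rw [e]
      exact neg_le_neg (h.circleAverage_mono n hr hrR ζ))
  simp only [mul_neg, integral_neg, neg_mul] at h2
  exact h1.trans (neg_le_neg_iff.1 h2)

end RieszApproximation

/-- Here `φ ζ = ⊥` is allowed, so the sub-mean value inequality at `ζ` says nothing. Fatou's lemma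
along `G n` is used instead, with bounds uniform in `n`. -/
theorem IsSubharmonic.lintegral_circle_neg_ne_top (hφ : IsSubharmonic φ) (hne : ∃ z, φ z ≠ ⊥)
    (ζ : ℂ) {R : ℝ} (hR : 0 < R) :
    ∫⁻ θ in Ioc 0 (2 * Real.pi), (-φ (circleMap ζ R θ)).toENNReal ≠ ⊤ := by
  obtain ⟨G, U, h⟩ := hφ.exists_rieszApproximation hne
  obtain ⟨C, hC0, hC⟩ := h.exists_le hφ ζ R
  obtain ⟨C', hC'⟩ := h.exists_circleAverage_ge hφ hne ζ hR
  have hlim : ∀ θ, Tendsto (fun n => (-(G n (circleMap ζ R θ) : EReal)).toENNReal) atTop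
      (𝓝 (-φ (circleMap ζ R θ)).toENNReal) := fun θ =>
    (EReal.continuous_toENNReal.tendsto _).comp
      ((continuous_neg.tendsto _).comp (h.tendsto hφ (circleMap ζ R θ)))
  have hcont : ∀ n, Continuous fun θ => G n (circleMap ζ R θ) := fun n =>
    (h.continuous n).comp (continuous_circleMap ζ R)
  have hmeas : ∀ n, Measurable fun θ => (-(G n (circleMap ζ R θ) : EReal)).toENNReal := fun n =>
    (hcont n).measurable.coe_real_ereal.neg.ereal_toENNReal
  have hbound : ∀ n, ∫⁻ θ in Ioc 0 (2 * Real.pi), (-(G n (circleMap ζ R θ) : EReal)).toENNReal ≤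
      ENNReal.ofReal (2 * Real.pi * (C + C')) := fun n => by
    have hi : IntegrableOn (fun θ => C - G n (circleMap ζ R θ)) (Ioc 0 (2 * Real.pi)) :=
      (continuous_const.sub (hcont n)).integrableOn_Ioc
    have hCG : ∀ θ, 0 ≤ C - G n (circleMap ζ R θ) := fun θ =>
      sub_nonneg.2 (hC n _ (by simp [circleMap, abs_of_pos hR]))
    calc _ ≤ ∫⁻ θ in Ioc 0 (2 * Real.pi), ENNReal.ofReal (C - G n (circleMap ζ R θ)) := by
          refine lintegral_mono fun θ => ?_
          rw [← EReal.coe_neg, EReal.real_coe_toENNReal]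
          exact ENNReal.ofReal_le_ofReal (by linarith)
      _ = ENNReal.ofReal (∫ θ in Ioc 0 (2 * Real.pi), (C - G n (circleMap ζ R θ))) :=
          (ofReal_integral_eq_lintegral_ofReal hi (ae_of_all _ hCG)).symm
      _ ≤ _ := by
          refine ENNReal.ofReal_le_ofReal ?_
          rw [integral_sub (by simp) (hcont n).integrableOn_Ioc]
          have h1 := hC' n ζ (by simpa using hR.le)
          rw [circleAverage_eq_setIntegral, ← div_eq_inv_mul, le_div_iff₀ Real.two_pi_pos] at h1
          rw [setIntegral_const, Measure.real, Real.volume_Ioc, sub_zero,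
            ENNReal.toReal_ofReal Real.two_pi_pos.le, smul_eq_mul]
          linarith
  refine ne_top_of_le_ne_top ENNReal.ofReal_ne_top ?_ (b := ENNReal.ofReal (2 * Real.pi * (C + C')))
  calc _ = ∫⁻ θ in Ioc 0 (2 * Real.pi),
        liminf (fun n => (-(G n (circleMap ζ R θ) : EReal)).toENNReal) atTop :=
        lintegral_congr fun θ => (hlim θ).liminf_eq.symm
    _ ≤ liminf (fun n => ∫⁻ θ in Ioc 0 (2 * Real.pi),
        (-(G n (circleMap ζ R θ) : EReal)).toENNReal) atTop := lintegral_liminf_le hmeas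
    _ ≤ _ := liminf_le_of_le (by isBoundedDefault) fun b hb => by
        obtain ⟨n, hn⟩ := hb.exists
        exact hn.trans (hbound n)

/-- Dominated convergence: `φ ≤ G n ≤ C`, and `φ` is integrable on the circle. -/
theorem RieszApproximation.tendsto_circleAverage (h : RieszApproximation φ G U)
    (hφ : IsSubharmonic φ) (hne : ∃ z, φ z ≠ ⊥) (ζ : ℂ) {R : ℝ} (hR : 0 < R) :
    Tendsto (fun n => Real.circleAverage (G n) ζ R) atTop
      (𝓝 (Real.circleAverage (fun z => (φ z).toReal) ζ R)) := by
  obtain ⟨C, hC0, hC⟩ := h.exists_le hφ ζ R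
  have hB := hφ.lintegral_circle_neg_ne_top hne ζ hR
  have hae := hφ.ae_circle_ne_bot hB
  have hint := (circleIntegrable_iff_integrableOn _ _ _).1 (hφ.circleIntegrable_of_lintegral hB).1
  simp only [circleAverage_eq_setIntegral]
  refine Tendsto.const_mul _ ?_
  refine tendsto_integral_of_dominated_convergence
    (fun θ => |(φ (circleMap ζ R θ)).toReal| + C) ?_ (hint.abs.add (by simp)) ?_ ?_
  · exact fun n => ((h.continuous n).comp (continuous_circleMap ζ R)).aestronglyMeasurable
  · intro n
    filter_upwards [hae] with θ hθ
    have h1 : (φ (circleMap ζ R θ)).toReal ≤ G n (circleMap ζ R θ) := by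
      rw [← EReal.coe_le_coe_iff, hφ.coe_toReal hθ]
      exact h.le n _
    have h2 := hC n (circleMap ζ R θ) (by simp [circleMap, abs_of_pos hR])
    rw [Real.norm_eq_abs, abs_le]
    constructor
    · linarith [neg_abs_le (φ (circleMap ζ R θ)).toReal]
    · linarith [abs_nonneg (φ (circleMap ζ R θ)).toReal]
  · filter_upwards [hae] with θ hθ
    have := h.tendsto hφ (circleMap ζ R θ)
    rw [← hφ.coe_toReal hθ] at this
    exact EReal.tendsto_coe.1 this

/-! ### The Lelong number as a slope -/

/-- Take for `ν` the infimum of all difference quotients. By convexity, every quotient to the left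
of a nearly minimal one is at most as large. -/
theorem exists_slope_atBot {h : ℝ → ℝ} (hmono : Monotone h)
    (hconv : ∀ s t u, s < t → t < u → (h t - h s) / (t - s) ≤ (h u - h t) / (u - t)) :
    ∃ ν : ℝ, 0 ≤ ν ∧ (∀ s t, s < t → ν * (t - s) ≤ h t - h s) ∧
      ∀ m, ν < m → ∃ T, ∀ s t, s < t → t ≤ T → h t - h s < m * (t - s) := by
  set S : Set ℝ := {x | ∃ s t, s < t ∧ x = (h t - h s) / (t - s)} with hS
  have hS0 : ∀ x ∈ S, 0 ≤ x := by
    rintro _ ⟨s, t, hst, rfl⟩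
    exact div_nonneg (sub_nonneg.2 (hmono hst.le)) (sub_nonneg.2 hst.le)
  have hSne : S.Nonempty := ⟨_, 0, 1, zero_lt_one, rfl⟩
  refine ⟨sInf S, le_csInf hSne hS0, fun s t hst => ?_, fun m hm => ?_⟩
  · rw [← le_div_iff₀ (sub_pos.2 hst)]
    exact csInf_le ⟨0, hS0⟩ ⟨s, t, hst, rfl⟩
  · obtain ⟨_, ⟨s₀, t₀, hst₀, rfl⟩, hlt⟩ := exists_lt_of_csInf_lt hSne hm
    refine ⟨s₀, fun s t hst hts => ?_⟩
    rw [← div_lt_iff₀ (sub_pos.2 hst)]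
    refine lt_of_le_of_lt ?_ hlt
    rcases hts.lt_or_eq with hlt' | rfl
    · exact (hconv s t s₀ hst hlt').trans (hconv t s₀ t₀ hlt' hst₀)
    · exact hconv s t t₀ hst hst₀

theorem tendsto_div_atBot_of_slope {h : ℝ → ℝ} {ν : ℝ}
    (h1 : ∀ s t, s < t → ν * (t - s) ≤ h t - h s)
    (h2 : ∀ m, ν < m → ∃ T, ∀ s t, s < t → t ≤ T → h t - h s < m * (t - s)) :
    Tendsto (fun s => h s / s) atBot (𝓝 ν) := by
  have hinv : ∀ c : ℝ, Tendsto (fun s : ℝ => c / s) atBot (𝓝 0) := fun c =>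
    tendsto_const_nhds.div_atBot tendsto_id
  refine tendsto_order.2 ⟨fun c hc => ?_, fun c hc => ?_⟩
  · have hl : Tendsto (fun s : ℝ => ν + h 0 / s) atBot (𝓝 (ν + 0)) := (hinv _).const_add ν
    rw [add_zero] at hl
    filter_upwards [hl.eventually (lt_mem_nhds hc), eventually_lt_atBot (0 : ℝ)] with s hs hs0
    refine hs.trans_le ?_
    rw [le_div_iff_of_neg hs0, add_mul, div_mul_cancel₀ _ hs0.ne]
    linarith [h1 s 0 hs0]
  · obtain ⟨m, hm1, hm2⟩ := exists_between hc
    obtain ⟨T, hT⟩ := h2 m hm1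
    have hl : Tendsto (fun s : ℝ => m + (h T - m * T) / s) atBot (𝓝 (m + 0)) :=
      (hinv _).const_add m
    rw [add_zero] at hl
    filter_upwards [hl.eventually (gt_mem_nhds hm2), eventually_lt_atBot (0 : ℝ),
      eventually_lt_atBot T] with s hs hs0 hsT
    refine lt_of_le_of_lt ?_ hs
    rw [div_le_iff_of_neg hs0, add_mul, div_mul_cancel₀ _ hs0.ne]
    linarith [hT s T hsT le_rfl]

theorem RieszApproximation.exists_slope (h : RieszApproximation φ G U) (hφ : IsSubharmonic φ)
    (hne : ∃ z, φ z ≠ ⊥) (z : ℂ) :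
    ∃ ν : ℝ, 0 ≤ ν ∧
      Tendsto (fun s => Real.circleAverage (fun z => (φ z).toReal) z (Real.exp s) / s) atBot (𝓝 ν) ∧
      (∀ m, ν < m → ∃ r, 0 < r ∧ ∀ᶠ n in atTop, ∫ w in Metric.ball z r, U n w < m) ∧
      ∀ m, m < ν → ∀ r, 0 < r → ∀ᶠ n in atTop, m < ∫ w in Metric.ball z r, U n w := by
  set N : ℝ → ℝ := fun s => Real.circleAverage (fun z => (φ z).toReal) z (Real.exp s) with hN
  have hlim : ∀ s, Tendsto (fun n => Real.circleAverage (G n) z (Real.exp s)) atTop (𝓝 (N s)) :=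
    fun s => h.tendsto_circleAverage hφ hne z (Real.exp_pos s)
  have hup : ∀ s t m, s < t → N t - N s < m * (t - s) →
      ∀ᶠ n in atTop, ∫ w in Metric.ball z (Real.exp s), U n w < m := fun s t m hst hm => by
    filter_upwards [((hlim t).sub (hlim s)).eventually (gt_mem_nhds hm)] with n hn
    have := (h.mul_mass_le n (Real.exp_pos s) (Real.exp_le_exp.2 hst.le) z).trans_lt hn
    rw [Real.log_exp, Real.log_exp, mul_comm] at this
    exact lt_of_mul_lt_mul_right this (sub_pos.2 hst).le
  have hdown : ∀ s t m, s < t → m * (t - s) < N t - N s →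
      ∀ᶠ n in atTop, m < ∫ w in Metric.ball z (Real.exp t), U n w := fun s t m hst hm => by
    filter_upwards [((hlim t).sub (hlim s)).eventually (lt_mem_nhds hm)] with n hn
    have := hn.trans_le (h.le_mul_mass n (Real.exp_pos s) (Real.exp_le_exp.2 hst.le) z)
    rw [Real.log_exp, Real.log_exp, mul_comm m] at this
    exact lt_of_mul_lt_mul_left this (sub_pos.2 hst).le
  have hmono : Monotone N := fun s t hst => le_of_tendsto_of_tendsto' (hlim s) (hlim t) fun n =>
    h.circleAverage_mono n (Real.exp_pos s) (Real.exp_le_exp.2 hst) z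
  have hconv : ∀ s t u, s < t → t < u → (N t - N s) / (t - s) ≤ (N u - N t) / (u - t) := by
    intro s t u hst htu
    -- If convexity failed, then for a value `m` strictly between the two slopes the disc of radius
    -- `e^t` would, for large `n`, have mass both below and above `m`.
    by_contra! hcon
    obtain ⟨m, hm1, hm2⟩ := exists_between hcon
    rw [div_lt_iff₀ (sub_pos.2 htu)] at hm1
    rw [lt_div_iff₀ (sub_pos.2 hst)] at hm2
    obtain ⟨n, hn1, hn2⟩ := ((hup t u m htu hm1).and (hdown s t m hst hm2)).exists
    exact lt_asymm hn1 hn2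
  obtain ⟨ν, hν0, hν1, hν2⟩ := exists_slope_atBot hmono hconv
  refine ⟨ν, hν0, tendsto_div_atBot_of_slope hν1 hν2, fun m hm => ?_, fun m hm r hr => ?_⟩
  · obtain ⟨T, hT⟩ := hν2 m hm
    exact ⟨Real.exp (T - 1), Real.exp_pos _, hup (T - 1) T m (by linarith)
      (hT _ _ (by linarith) le_rfl)⟩
  · have := hdown (Real.log r - 1) (Real.log r) m (by linarith)
      (lt_of_lt_of_le (by linarith) (hν1 _ _ (by linarith)))
    rwa [Real.exp_log hr] at this

/-- An upper bound for a subharmonic function by a logarithm, given lower bounds for the Riesz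
masses. -/
theorem RieszApproximation.exists_le_log (h : RieszApproximation φ G U) (hφ : IsSubharmonic φ)
    {z : ℂ} {ν : ℝ}
    (hν : ∀ m, m < ν → ∀ r, 0 < r → ∀ᶠ n in atTop, m < ∫ w in Metric.ball z r, U n w) :
    ∃ C : ℝ, ∀ ζ, ζ ≠ z → ‖ζ - z‖ < 1 → φ ζ ≤ ((C + ν * Real.log ‖ζ - z‖ : ℝ) : EReal) := by
  obtain ⟨C, hC0, hC⟩ := h.exists_le hφ z 2
  refine ⟨C, fun ζ hζ hζ1 => ?_⟩
  set d := ‖ζ - z‖ with hd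
  have hd0 : 0 < d := norm_pos_iff.2 (sub_ne_zero.2 hζ)
  have key : ∀ η, 0 < η → d + η < 1 → φ ζ ≤ ((C + (ν - η) * Real.log (d + η) : ℝ) : EReal) := by
    intro η hη hdη
    -- The disc of radius `η` about `z` carries mass more than `ν - η`, and on it, off `ζ`, the
    -- kernel of radius `1` centred at `ζ` is at least `-log (d + η)`.
    obtain ⟨n, hn⟩ := (hν (ν - η) (by linarith) η hη).exists
    refine (h.le n ζ).trans (EReal.coe_le_coe_iff.2 ?_)
    have hlog : Real.log (d + η) < 0 := Real.log_neg (by linarith) hdη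
    have h1 : -Real.log (d + η) * ∫ w in Metric.ball z η, U n w ≤
        ∫ w, logKernel 1 (w - ζ) * U n w := by
      rw [← integral_indicator measurableSet_ball, ← integral_const_mul]
      refine integral_mono_ae (((integrable_indicator_iff measurableSet_ball).2
        (h.integrableOn_density n z η)).const_mul _) (h.integrable n one_pos ζ) ?_
      have : ∀ᵐ x : ℂ, x ≠ ζ := by simp [ae_iff]
      filter_upwards [this] with w hw
      by_cases hwz : w ∈ Metric.ball z η
      · rw [indicator_of_mem hwz]
        refine mul_le_mul_of_nonneg_right ?_ (h.density_nonneg n w)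
        rw [Metric.mem_ball, dist_eq_norm] at hwz
        have hwζ : ‖w - ζ‖ ≤ d + η := by
          calc ‖w - ζ‖ = ‖(w - z) - (ζ - z)‖ := by ring_nf
            _ ≤ ‖w - z‖ + ‖ζ - z‖ := norm_sub_le _ _
            _ ≤ d + η := by linarith
        rw [logKernel_eq_log one_pos (sub_ne_zero.2 hw) (by linarith), Real.log_one, zero_sub]
        exact neg_le_neg (Real.log_le_log (norm_pos_iff.2 (sub_ne_zero.2 hw)) hwζ)
      · rw [indicator_of_notMem hwz, mul_zero]
        exact mul_nonneg (logKernel_nonneg _ _) (h.density_nonneg n w)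
    rw [h.integral_sub_eq n one_pos ζ] at h1
    have h2 : Real.circleAverage (G n) ζ 1 ≤ C := by
      refine Real.circleAverage_mono_on_of_le_circle (h.circleIntegrable n ζ 1) fun w hw => ?_
      rw [abs_one, mem_sphere_iff_norm] at hw
      refine hC n w ?_
      calc ‖w - z‖ = ‖(w - ζ) + (ζ - z)‖ := by ring_nf
        _ ≤ ‖w - ζ‖ + ‖ζ - z‖ := norm_add_le _ _
        _ ≤ 2 := by linarith
    have h3 := mul_le_mul_of_nonneg_left hn.le (neg_nonneg.2 hlog.le)
    linarith
  by_cases hbot : φ ζ = ⊥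
  · simp [hbot]
  rw [← hφ.coe_toReal hbot, EReal.coe_le_coe_iff]
  -- Now let `η` tend to `0`.
  have hc : ContinuousAt (fun η : ℝ => C + (ν - η) * Real.log (d + η)) 0 := by
    refine continuousAt_const.add ((continuousAt_const.sub continuousAt_id).mul ?_)
    exact ContinuousAt.log (by fun_prop) (by simpa using hd0.ne')
  have hl : Tendsto (fun η : ℝ => C + (ν - η) * Real.log (d + η)) (𝓝[>] 0)
      (𝓝 (C + ν * Real.log d)) := by
    have := hc.tendsto
    simp only [sub_zero, add_zero] at this
    exact this.mono_left nhdsWithin_le_nhds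
  refine ge_of_tendsto hl ?_
  have hmem : Ioo (0 : ℝ) (1 - d) ∈ 𝓝[>] (0 : ℝ) := Ioo_mem_nhdsGT (by linarith)
  filter_upwards [hmem] with η hη
  have := key η hη.1 (by linarith [hη.2])
  rwa [← hφ.coe_toReal hbot, EReal.coe_le_coe_iff] at this

theorem IsSubharmonic.exists_iSup_sphere_eq (hφ : IsSubharmonic φ) (hne : ∃ z, φ z ≠ ⊥) (z : ℂ)
    {r : ℝ} (hr : 0 < r) :
    ∃ s : ℝ, (⨆ ζ ∈ Metric.sphere z r, φ ζ) = (s : EReal) ∧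
      Real.circleAverage (fun z => (φ z).toReal) z r ≤ s := by
  obtain ⟨C, hC0, hC⟩ := hφ.exists_le z r
  have hB := hφ.lintegral_circle_neg_ne_top hne z hr
  have hae := hφ.ae_circle_ne_bot hB
  have hle : (⨆ ζ ∈ Metric.sphere z r, φ ζ) ≤ (C : EReal) := iSup₂_le fun ζ hζ =>
    hC ζ (mem_sphere_iff_norm.1 hζ).le
  have hle' : ∀ θ, φ (circleMap z r θ) ≤ ⨆ ζ ∈ Metric.sphere z r, φ ζ := fun θ =>
    le_iSup₂ (f := fun ζ (_ : ζ ∈ Metric.sphere z r) => φ ζ) _ (circleMap_mem_sphere z hr.le θ)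
  have hnebot : (⨆ ζ ∈ Metric.sphere z r, φ ζ) ≠ ⊥ := by
    intro hbot
    have : (ae (volume.restrict (Ioc 0 (2 * Real.pi)))).NeBot := by
      rw [ae_neBot, Ne, Measure.restrict_eq_zero]
      simp [Real.pi_pos]
    obtain ⟨θ, hθ⟩ := hae.exists
    exact hθ (le_bot_iff.1 (hbot ▸ hle' θ))
  have hcoe := EReal.coe_toReal (ne_top_of_le_ne_top (EReal.coe_ne_top C) hle) hnebot
  refine ⟨_, hcoe.symm, ?_⟩
  set s := (⨆ ζ ∈ Metric.sphere z r, φ ζ).toReal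
  have hint := (circleIntegrable_iff_integrableOn _ _ _).1 (hφ.circleIntegrable_of_lintegral hB).1
  rw [circleAverage_eq_setIntegral, ← div_eq_inv_mul, div_le_iff₀ Real.two_pi_pos]
  have h1 : ∫ θ in Ioc 0 (2 * Real.pi), (φ (circleMap z r θ)).toReal ≤
      ∫ θ in Ioc 0 (2 * Real.pi), s := by
    refine integral_mono_ae hint (by simp) ?_
    filter_upwards [hae] with θ hθ
    rw [← EReal.coe_le_coe_iff, hφ.coe_toReal hθ, hcoe]
    exact hle' θ
  refine h1.trans_eq ?_
  rw [setIntegral_const, Measure.real, Real.volume_Ioc, sub_zero,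
    ENNReal.toReal_ofReal Real.two_pi_pos.le, smul_eq_mul, mul_comm]

theorem RieszApproximation.exists_lelong (h : RieszApproximation φ G U) (hφ : IsSubharmonic φ)
    (hne : ∃ z, φ z ≠ ⊥) (z : ℂ) :
    ∃ ν : ℝ, 0 ≤ ν ∧ Tendsto (lelongQuotient φ z) (𝓝[>] 0) (𝓝 (ν : EReal)) ∧
      (∃ C : ℝ, ∀ ζ, ζ ≠ z → ‖ζ - z‖ < 1 → φ ζ ≤ ((C + ν * Real.log ‖ζ - z‖ : ℝ) : EReal)) ∧
      ∀ m, ν < m → ∃ r, 0 < r ∧ ∀ᶠ n in atTop, ∫ w in Metric.ball z r, U n w < m := by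
  obtain ⟨ν, hν0, hlim, hup, hdown⟩ := h.exists_slope hφ hne z
  obtain ⟨C, hC⟩ := h.exists_le_log hφ hdown
  refine ⟨ν, hν0, ?_, ⟨C, hC⟩, hup⟩
  choose! s hs1 hs2 using fun r (hr : 0 < r) => hφ.exists_iSup_sphere_eq hne z hr
  have hq : ∀ᶠ r in 𝓝[>] (0 : ℝ), lelongQuotient φ z r = ((s r / Real.log r : ℝ) : EReal) := by
    filter_upwards [self_mem_nhdsWithin] with r hr
    rw [lelongQuotient, hs1 r hr, EReal.coe_div]
  refine Tendsto.congr' (EventuallyEq.symm hq) (EReal.tendsto_coe.2 ?_)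
  have hlog := Real.tendsto_log_nhdsGT_zero
  have hl1 : Tendsto (fun r => ν + C / Real.log r) (𝓝[>] 0) (𝓝 ν) := by
    have := (tendsto_const_nhds (x := C)).div_atBot hlog |>.const_add ν
    simpa using this
  have hl2 := hlim.comp hlog
  have hmem : Ioo (0 : ℝ) 1 ∈ 𝓝[>] (0 : ℝ) := Ioo_mem_nhdsGT one_pos
  -- Division by `log r < 0` reverses both bounds: the upper bound for the maximum gives the lower
  -- bound for the quotient, and the circle mean gives the upper one.
  refine tendsto_of_tendsto_of_tendsto_of_le_of_le' hl1 hl2 ?_ ?_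
  · filter_upwards [hmem] with r hr
    have hneg := Real.log_neg hr.1 hr.2
    rw [le_div_iff_of_neg hneg, add_mul, div_mul_cancel₀ _ hneg.ne, ← EReal.coe_le_coe_iff,
      ← hs1 r hr.1]
    refine iSup₂_le fun ζ hζ => ?_
    rw [mem_sphere_iff_norm] at hζ
    have hζz : ζ ≠ z := fun e => by simp [e] at hζ; linarith [hr.1]
    have := hC ζ hζz (hζ ▸ hr.2)
    rwa [hζ, add_comm] at this
  · filter_upwards [hmem] with r hr
    have hneg := Real.log_neg hr.1 hr.2
    simp only [Function.comp_apply]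
    rw [Real.exp_log hr.1]
    exact div_le_div_of_nonpos_of_le hneg.le (hs2 r hr.1)

end

/-! ### Integrability of the exponential of a potential -/

section

/-- Jensen's inequality for a measure with density `u` of total mass at most `m`. -/
theorem ofReal_exp_integral_le {α : Type*} [MeasurableSpace α] {μ : Measure α} {k u : α → ℝ}
    (hk : Measurable k) (hu : Measurable u) (hu0 : ∀ x, 0 ≤ u x) (hui : Integrable u μ)
    (hkui : Integrable (fun x => k x * u x) μ) {m : ℝ} (hm : 0 < m) (hum : ∫ x, u x ∂μ ≤ m) :
    ENNReal.ofReal (Real.exp (∫ x, k x * u x ∂μ)) ≤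
      1 + ENNReal.ofReal m⁻¹ * ∫⁻ x, ENNReal.ofReal (Real.exp (m * k x) * u x) ∂μ := by
  have hnn : ∀ x, 0 ≤ Real.exp (m * k x) * u x := fun x =>
    mul_nonneg (Real.exp_pos _).le (hu0 x)
  by_cases htop : ∫⁻ x, ENNReal.ofReal (Real.exp (m * k x) * u x) ∂μ = ⊤
  · rw [htop, ENNReal.mul_top (by simpa using hm)]
    simp
  have hint : Integrable (fun x => Real.exp (m * k x) * u x) μ := by
    refine ⟨((hk.const_mul m).exp.mul hu).aestronglyMeasurable, ?_⟩
    rw [hasFiniteIntegral_iff_ofReal (ae_of_all _ hnn)]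
    exact lt_top_iff_ne_top.2 htop
  rw [← ofReal_integral_eq_lintegral_ofReal hint (ae_of_all _ hnn),
    ← ENNReal.ofReal_mul (by positivity), ← ENNReal.ofReal_one,
    ← ENNReal.ofReal_add zero_le_one (mul_nonneg (by positivity) (integral_nonneg hnn))]
  refine ENNReal.ofReal_le_ofReal ?_
  set x₀ := ∫ x, k x * u x ∂μ with hx₀
  set M := ∫ x, u x ∂μ with hM
  set E := ∫ x, Real.exp (m * k x) * u x ∂μ with hE
  -- Integrate against `u` the inequality placing `exp` above its tangent at `x₀`.
  have h1 : Real.exp x₀ * ((1 - x₀) * M + m * x₀) ≤ E := by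
    rw [hM, hx₀, ← integral_const_mul, ← integral_const_mul, ← hx₀,
      ← integral_add (hui.const_mul _) (hkui.const_mul _), ← integral_const_mul]
    refine integral_mono (((hui.const_mul _).add (hkui.const_mul _)).const_mul _) hint fun x => ?_
    have h2 := Real.add_one_le_exp (m * k x - x₀)
    have h3 : Real.exp x₀ * (m * k x - x₀ + 1) ≤ Real.exp (m * k x) := by
      calc _ ≤ Real.exp x₀ * Real.exp (m * k x - x₀) := by gcongr
        _ = _ := by rw [← Real.exp_add]; ring_nf
    have h4 := mul_le_mul_of_nonneg_right h3 (hu0 x)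
    linarith
  have h5 : Real.exp x₀ * (1 - x₀) ≤ 1 := by
    have := Real.add_one_le_exp (-x₀)
    calc Real.exp x₀ * (1 - x₀) ≤ Real.exp x₀ * Real.exp (-x₀) := by gcongr; linarith
      _ = 1 := by rw [← Real.exp_add]; simp
  have hM0 : 0 ≤ M := integral_nonneg hu0
  -- This accounts for the missing mass `m - M`, as if it lay where `k = 0`.
  have h6 := mul_le_mul_of_nonneg_right h5 (sub_nonneg.2 hum)
  have h7 : m * Real.exp x₀ ≤ m + E := by linarith
  calc Real.exp x₀ = m⁻¹ * (m * Real.exp x₀) := by field_simp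
    _ ≤ m⁻¹ * (m + E) := by gcongr
    _ = 1 + m⁻¹ * E := by field_simp

/-- Inside the disc the left side is `(ρ / ‖v‖)^m`, and `|v.re| ≤ ‖v‖`; outside it is `1`. Keeping
only the real part makes the bound independent of the height of the graph. -/
theorem ofReal_exp_mul_logKernel_le {m ρ : ℝ} (hm : 0 < m) (hρ : 0 < ρ) (v : ℂ) :
    ENNReal.ofReal (Real.exp (m * logKernel ρ v)) ≤
      1 + ENNReal.ofReal (ρ ^ m) * ENNReal.ofReal |v.re| ^ (-m) := by
  by_cases hv : v.re = 0
  · rw [hv, abs_zero, ENNReal.ofReal_zero, ENNReal.zero_rpow_of_neg (neg_neg_of_pos hm),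
      ENNReal.mul_top (by simpa using Real.rpow_pos_of_pos hρ m)]
    simp
  have hs : 0 < |v.re| := abs_pos.2 hv
  have hv0 : 0 < ‖v‖ := hs.trans_le (Complex.abs_re_le_norm v)
  rw [ENNReal.ofReal_rpow_of_pos hs, ← ENNReal.ofReal_mul (by positivity), ← ENNReal.ofReal_one,
    ← ENNReal.ofReal_add zero_le_one (by positivity)]
  refine ENNReal.ofReal_le_ofReal ?_
  by_cases hvρ : ‖v‖ ≤ ρ
  · rw [logKernel_eq_log hρ (norm_pos_iff.1 hv0) hvρ]
    have e : Real.exp (m * (Real.log ρ - Real.log ‖v‖)) = ρ ^ m * ‖v‖ ^ (-m) := by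
      rw [Real.rpow_def_of_pos hρ, Real.rpow_def_of_pos hv0, ← Real.exp_add]
      ring_nf
    rw [e]
    have h1 : ‖v‖ ^ (-m) ≤ |v.re| ^ (-m) :=
      Real.rpow_le_rpow_of_nonpos hs (Complex.abs_re_le_norm v) (by linarith)
    have h2 : ρ ^ m * ‖v‖ ^ (-m) ≤ ρ ^ m * |v.re| ^ (-m) := by gcongr
    linarith
  · rw [logKernel_eq_zero hρ (not_le.1 hvρ).le, mul_zero, Real.exp_zero]
    have : 0 ≤ ρ ^ m * |v.re| ^ (-m) := by positivity
    linarith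

/-- The power is at most `1` at distance at least `1` and integrable near its pole because `m < 1`;
translation invariance makes the bound uniform in `c`. -/
theorem exists_lintegral_abs_rpow_le {m : ℝ} (hm0 : 0 < m) (hm : m < 1) (a b : ℝ) :
    ∃ K : ℝ≥0∞, K ≠ ⊤ ∧ ∀ c, ∫⁻ t in Icc a b, ENNReal.ofReal |c - t| ^ (-m) ≤ K := by
  have hfin : ∫⁻ s in Metric.ball (0 : ℝ) 1, ENNReal.ofReal |s| ^ (-m) < ⊤ := by
    have h1 : IntegrableOn (fun y : ℝ => y ^ (Module.finrank ℝ ℝ - 1) • y ^ (-m)) (Ioo 0 1) := by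
      have := (intervalIntegral.intervalIntegrable_rpow' (a := 0) (b := 1) (r := -m) (by linarith))
      rw [intervalIntegrable_iff_integrableOn_Ioo_of_le zero_le_one] at this
      simpa using this
    have h2 := (integrableOn_fun_norm_addHaar (E := ℝ) volume
      (f := fun y : ℝ => y ^ (-m)) (r := 1)).2 h1
    have h3 := h2.2
    rw [hasFiniteIntegral_iff_ofReal (ae_of_all _ fun x => by positivity)] at h3
    refine lt_of_eq_of_lt (lintegral_congr_ae ?_) h3
    have : ∀ᵐ s : ℝ, s ≠ 0 := by simp [ae_iff]
    filter_upwards [ae_restrict_of_ae this] with s hs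
    rw [ENNReal.ofReal_rpow_of_pos (abs_pos.2 hs), Real.norm_eq_abs]
  refine ⟨ENNReal.ofReal (b - a) + ∫⁻ s in Metric.ball (0 : ℝ) 1, ENNReal.ofReal |s| ^ (-m),
    ENNReal.add_ne_top.2 ⟨ENNReal.ofReal_ne_top, hfin.ne⟩, fun c => ?_⟩
  set F : ℝ → ℝ≥0∞ := (Metric.ball (0 : ℝ) 1).indicator fun s => ENNReal.ofReal |s| ^ (-m) with hF
  calc ∫⁻ t in Icc a b, ENNReal.ofReal |c - t| ^ (-m) ≤ ∫⁻ t in Icc a b, (1 + F (c - t)) := by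
        refine lintegral_mono fun t => ?_
        simp only [hF]
        by_cases h : c - t ∈ Metric.ball (0 : ℝ) 1
        · rw [indicator_of_mem h]
          exact le_add_self
        · rw [indicator_of_notMem h, add_zero]
          rw [mem_ball_zero_iff, not_lt, Real.norm_eq_abs] at h
          rw [ENNReal.rpow_neg, ENNReal.inv_le_one]
          exact ENNReal.one_le_rpow (by simpa using h) hm0
    _ = ENNReal.ofReal (b - a) + ∫⁻ t in Icc a b, F (c - t) := by
        rw [lintegral_add_left measurable_const]
        simp
    _ ≤ ENNReal.ofReal (b - a) + ∫⁻ t, F (c - t) := by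
        gcongr
        exact Measure.restrict_le_self
    _ = _ := by
        rw [lintegral_sub_left_eq_self F c, hF, lintegral_indicator measurableSet_ball]

variable {φ : ℂ → EReal} {G U : ℕ → ℂ → ℝ}

theorem RieszApproximation.ofReal_exp_neg_le (h : RieszApproximation φ G U) {n : ℕ} {z ζ : ℂ}
    {ρ m C : ℝ} (hρ : 0 < ρ) (hm : 0 < m) (hmass : ∫ w in Metric.ball z (2 * ρ), U n w ≤ m)
    (hζ : ‖ζ - z‖ ≤ ρ) (hC : -C ≤ Real.circleAverage (G n) ζ ρ) :
    ENNReal.ofReal (Real.exp (-G n ζ)) ≤ ENNReal.ofReal (Real.exp C) *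
      (1 + ENNReal.ofReal m⁻¹ * ∫⁻ w in Metric.ball z (2 * ρ), ENNReal.ofReal (U n w) *
        (1 + ENNReal.ofReal (ρ ^ m) * ENNReal.ofReal |w.re - ζ.re| ^ (-m))) := by
  -- The kernel lives on the disc of radius `ρ` about `ζ`, which lies in that of radius `2ρ` about
  -- `z`.
  have hsupp : ∫ w, logKernel ρ (w - ζ) * U n w =
      ∫ w in Metric.ball z (2 * ρ), logKernel ρ (w - ζ) * U n w := by
    refine (setIntegral_eq_integral_of_forall_compl_eq_zero fun w hw => ?_).symm
    rw [Metric.mem_ball, dist_eq_norm, not_lt] at hw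
    rw [logKernel_eq_zero hρ, zero_mul]
    have : ‖w - z‖ ≤ ‖w - ζ‖ + ‖ζ - z‖ := norm_sub_le_norm_sub_add_norm_sub _ _ _
    linarith
  have h1 : -G n ζ ≤ C + ∫ w in Metric.ball z (2 * ρ), logKernel ρ (w - ζ) * U n w := by
    rw [← hsupp, h.integral_sub_eq n hρ]
    linarith
  have hmk : Measurable fun w => logKernel ρ (w - ζ) :=
    (measurable_logKernel ρ).comp (measurable_id.sub_const ζ)
  have h2 := ofReal_exp_integral_le (μ := volume.restrict (Metric.ball z (2 * ρ))) hmk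
    (h.continuous_density n).measurable (h.density_nonneg n) (h.integrableOn_density n z _)
    (h.integrable n hρ ζ).integrableOn hm hmass
  calc ENNReal.ofReal (Real.exp (-G n ζ)) ≤ ENNReal.ofReal (Real.exp C * Real.exp
        (∫ w in Metric.ball z (2 * ρ), logKernel ρ (w - ζ) * U n w)) := by
        rw [← Real.exp_add]
        exact ENNReal.ofReal_le_ofReal (Real.exp_le_exp.2 h1)
    _ = ENNReal.ofReal (Real.exp C) * ENNReal.ofReal (Real.exp
        (∫ w in Metric.ball z (2 * ρ), logKernel ρ (w - ζ) * U n w)) :=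
        ENNReal.ofReal_mul (Real.exp_pos _).le
    _ ≤ _ := by
        gcongr
        refine h2.trans ?_
        gcongr with w
        rw [mul_comm, ENNReal.ofReal_mul (h.density_nonneg n w)]
        gcongr
        exact ofReal_exp_mul_logKernel_le hm hρ (w - ζ)

/-! ### Integration along a graph -/

theorem continuousOn_graphCurve {y : ℝ → ℝ} {s : Set ℝ} (hy : ContinuousOn y s) :
    ContinuousOn (graphCurve y) s := by
  have : graphCurve y = fun t : ℝ => (t : ℂ) + y t * Complex.I := by
    funext t
    exact Complex.mk_eq_add_mul_I t (y t)
  rw [this]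
  fun_prop

theorem norm_graphCurve_sub_le {y : ℝ → ℝ} {L : ℝ≥0} {s : Set ℝ} (hy : LipschitzOnWith L y s)
    {t u : ℝ} (ht : t ∈ s) (hu : u ∈ s) :
    ‖graphCurve y t - graphCurve y u‖ ≤ (1 + L) * |t - u| := by
  have h := hy.dist_le_mul t ht u hu
  rw [Real.dist_eq, Real.dist_eq] at h
  calc ‖graphCurve y t - graphCurve y u‖ ≤ |t - u| + |y t - y u| :=
        Complex.norm_le_abs_re_add_abs_im _
    _ ≤ (1 + L) * |t - u| := by linarith

theorem arcLintegral_le {y : ℝ → ℝ} {L : ℝ≥0} {a b : ℝ} (hy : LipschitzOnWith L y (Icc a b))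
    (H : ℂ → ℝ≥0∞) :
    arcLintegral y a b H ≤
      ENNReal.ofReal √(1 + (L : ℝ) ^ 2) * ∫⁻ t in Icc a b, H (graphCurve y t) := by
  -- The endpoints are dropped: `deriv y` is two-sided there and `y` is not controlled outside `[a,
  -- b]`.
  rw [arcLintegral, ← Measure.restrict_congr_set Ioo_ae_eq_Icc, ← lintegral_const_mul' _ _ ENNReal.ofReal_ne_top]
  refine setLIntegral_mono_ae' measurableSet_Ioo (ae_of_all _ fun t ht => ?_)
  rw [mul_comm]
  gcongr ENNReal.ofReal √(1 + ?_) * _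
  have := norm_deriv_le_of_lipschitzOn (Icc_mem_nhds ht.1 ht.2) hy
  rw [Real.norm_eq_abs] at this
  exact sq_le_sq' (neg_le_of_abs_le this) (le_of_abs_le this)

/-- After Tonelli the integral over `t` is bounded uniformly in `w`, and the mass bound `m` cancels
the factor `m⁻¹` from Jensen's inequality. The result does not depend on `n`. -/
theorem RieszApproximation.lintegral_graph_le (h : RieszApproximation φ G U) (y : ℝ → ℝ) (a b : ℝ)
    {n : ℕ} {z : ℂ} {ρ m C : ℝ} (hρ : 0 < ρ) (hm : 0 < m)
    (hmass : ∫ w in Metric.ball z (2 * ρ), U n w ≤ m)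
    (hC : ∀ ζ, ‖ζ - z‖ ≤ ρ → -C ≤ Real.circleAverage (G n) ζ ρ) {K : ℝ≥0∞}
    (hK : ∀ c, ∫⁻ t in Icc a b, ENNReal.ofReal |c - t| ^ (-m) ≤ K) :
    ∫⁻ t in Icc a b, (Metric.ball z ρ).indicator (fun ζ => ENNReal.ofReal (Real.exp (-G n ζ)))
        (graphCurve y t) ≤
      ENNReal.ofReal (Real.exp C) * (ENNReal.ofReal (b - a) +
        (ENNReal.ofReal (b - a) + ENNReal.ofReal (ρ ^ m) * K)) := by
  set B := Metric.ball z (2 * ρ)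
  have hUm : Measurable fun w => ENNReal.ofReal (U n w) :=
    (h.continuous_density n).measurable.ennreal_ofReal
  have hmeas : Measurable (Function.uncurry fun (t : ℝ) (w : ℂ) => ENNReal.ofReal (U n w) *
      (1 + ENNReal.ofReal (ρ ^ m) * ENNReal.ofReal |w.re - t| ^ (-m))) := by
    refine (hUm.comp measurable_snd).mul (Measurable.const_add (Measurable.const_mul ?_ _) _)
    refine Measurable.pow_const (Measurable.ennreal_ofReal (Continuous.measurable ?_)) _
    fun_prop
  have hinner : ∀ w : ℂ, ∫⁻ t in Icc a b, ENNReal.ofReal (U n w) *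
      (1 + ENNReal.ofReal (ρ ^ m) * ENNReal.ofReal |w.re - t| ^ (-m)) ≤
      ENNReal.ofReal (U n w) * (ENNReal.ofReal (b - a) + ENNReal.ofReal (ρ ^ m) * K) := fun w => by
    rw [lintegral_const_mul' _ _ ENNReal.ofReal_ne_top, lintegral_add_left measurable_const,
      lintegral_const_mul' _ _ ENNReal.ofReal_ne_top]
    gcongr
    · simp
    · exact hK w.re
  have hmass' : ∫⁻ w in B, ENNReal.ofReal (U n w) ≤ ENNReal.ofReal m := by
    rw [← ofReal_integral_eq_lintegral_ofReal (h.integrableOn_density n z _)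
      (ae_of_all _ (h.density_nonneg n))]
    exact ENNReal.ofReal_le_ofReal hmass
  calc _ ≤ ∫⁻ t in Icc a b, ENNReal.ofReal (Real.exp C) *
        (1 + ENNReal.ofReal m⁻¹ * ∫⁻ w in B, ENNReal.ofReal (U n w) *
        (1 + ENNReal.ofReal (ρ ^ m) * ENNReal.ofReal |w.re - t| ^ (-m))) := by
        refine lintegral_mono fun t => ?_
        refine indicator_apply_le' (fun ht => ?_) fun _ => zero_le
        rw [Metric.mem_ball, dist_eq_norm] at ht
        exact h.ofReal_exp_neg_le hρ hm hmass ht.le (hC _ ht.le)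
    _ = ENNReal.ofReal (Real.exp C) * (ENNReal.ofReal (b - a) + ENNReal.ofReal m⁻¹ *
        ∫⁻ w in B, ∫⁻ t in Icc a b, ENNReal.ofReal (U n w) *
        (1 + ENNReal.ofReal (ρ ^ m) * ENNReal.ofReal |w.re - t| ^ (-m))) := by
        rw [lintegral_const_mul' _ _ ENNReal.ofReal_ne_top, lintegral_add_left measurable_const,
          lintegral_const_mul' _ _ ENNReal.ofReal_ne_top,
          lintegral_lintegral_swap hmeas.aemeasurable]
        simp
    _ ≤ ENNReal.ofReal (Real.exp C) * (ENNReal.ofReal (b - a) + ENNReal.ofReal m⁻¹ *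
        (ENNReal.ofReal m * (ENNReal.ofReal (b - a) + ENNReal.ofReal (ρ ^ m) * K))) := by
        gcongr
        refine (lintegral_mono hinner).trans ?_
        rw [lintegral_mul_const _ hUm]
        gcongr
    _ = _ := by
        rw [← mul_assoc (ENNReal.ofReal m⁻¹), ← ENNReal.ofReal_mul (by positivity),
          inv_mul_cancel₀ hm.ne', ENNReal.ofReal_one, one_mul]

theorem RieszApproximation.locIntegrableOnGraphAt (h : RieszApproximation φ G U)
    (hφ : IsSubharmonic φ) (hne : ∃ z, φ z ≠ ⊥) {y : ℝ → ℝ} {L : ℝ≥0} {a b : ℝ}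
    (hy : LipschitzOnWith L y (Icc a b)) {z : ℂ} {m r : ℝ} (hm0 : 0 < m) (hm1 : m < 1) (hr : 0 < r)
    (hmass : ∀ᶠ n in atTop, ∫ w in Metric.ball z r, U n w < m) :
    LocIntegrableOnGraphAt y a b (fun z => EReal.exp (-φ z)) z := by
  obtain ⟨ρ, hρ, rfl⟩ : ∃ ρ, 0 < ρ ∧ r = 2 * ρ := ⟨r / 2, by positivity, by ring⟩
  obtain ⟨C, hC⟩ := h.exists_circleAverage_ge hφ hne z hρ
  obtain ⟨K, hKtop, hK⟩ := exists_lintegral_abs_rpow_le hm0 hm1 a b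
  refine ⟨Metric.ball z ρ, Metric.ball_mem_nhds z hρ, (arcLintegral_le hy _).trans_lt ?_⟩
  refine ENNReal.mul_lt_top ENNReal.ofReal_lt_top ?_
  set F : ℕ → ℂ → ℝ≥0∞ := fun n =>
    (Metric.ball z ρ).indicator fun ζ => ENNReal.ofReal (Real.exp (-G n ζ)) with hF
  have hFm : ∀ n, Measurable (F n) := fun n =>
    (h.continuous n).neg.rexp.measurable.ennreal_ofReal.indicator measurableSet_ball
  have hlim : ∀ ζ, Tendsto (fun n => F n ζ) atTop
      (𝓝 ((Metric.ball z ρ).indicator (fun z => EReal.exp (-φ z)) ζ)) := fun ζ => by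
    by_cases hζ : ζ ∈ Metric.ball z ρ
    · simp only [hF, indicator_of_mem hζ]
      have := (ENNReal.continuous_exp.tendsto _).comp
        ((continuous_neg.tendsto _).comp (h.tendsto hφ ζ))
      simpa [Function.comp_def, ← EReal.coe_neg] using this
    · simp only [hF, indicator_of_notMem hζ]
      exact tendsto_const_nhds
  have hγ : AEMeasurable (graphCurve y) (volume.restrict (Icc a b)) :=
    (continuousOn_graphCurve hy.continuousOn).aemeasurable measurableSet_Icc
  refine lt_of_le_of_lt (b := ENNReal.ofReal (Real.exp C) * (ENNReal.ofReal (b - a) +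
        (ENNReal.ofReal (b - a) + ENNReal.ofReal (ρ ^ m) * K))) ?_ ?_
  · calc _ = ∫⁻ t in Icc a b, liminf (fun n => F n (graphCurve y t)) atTop :=
          lintegral_congr fun t => (hlim _).liminf_eq.symm
      _ ≤ liminf (fun n => ∫⁻ t in Icc a b, F n (graphCurve y t)) atTop :=
          lintegral_liminf_le' fun n => (hFm n).comp_aemeasurable hγ
      -- One index `n` at which the mass bound also holds suffices for each `c`.
      _ ≤ _ := liminf_le_of_le (by isBoundedDefault) fun c hc => by
          obtain ⟨n, hn1, hn2⟩ := (hc.and hmass).exists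
          exact hn1.trans (h.lintegral_graph_le y a b hρ hm0 hn2.le (hC n) hK)
  · exact ENNReal.mul_lt_top ENNReal.ofReal_lt_top (ENNReal.add_lt_top.2
      ⟨ENNReal.ofReal_lt_top, ENNReal.add_lt_top.2 ⟨ENNReal.ofReal_lt_top,
        ENNReal.mul_lt_top ENNReal.ofReal_lt_top hKtop.lt_top⟩⟩)

theorem exists_mem_Icc_ne_abs_lt {a b t η : ℝ} (hab : a < b) (ht : t ∈ Icc a b) (hη : 0 < η) :
    ∃ u ∈ Icc a b, u ≠ t ∧ |u - t| < η := by
  have : (𝓝[Icc a b \ {t}] t).NeBot := by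
    have hpre : IsPreconnected (Icc a b) := isPreconnected_Icc
    have := hpre.preperfect_of_nontrivial ⟨a, left_mem_Icc.2 hab.le, b, right_mem_Icc.2 hab.le, hab.ne⟩
      t ht
    rw [accPt_principal_iff_nhdsWithin] at this
    exact this
  have hmem : (Icc a b \ {t}) ∩ Metric.ball t η ∈ 𝓝[Icc a b \ {t}] t :=
    inter_mem self_mem_nhdsWithin (mem_nhdsWithin_of_mem_nhds (Metric.ball_mem_nhds t hη))
  obtain ⟨u, ⟨hu, hut⟩, hball⟩ := Filter.nonempty_of_mem hmem
  exact ⟨u, hu, hut, by simpa [Real.dist_eq] using hball⟩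

/-- If `φ ≤ log |· - γ(t)| + C` near `γ(t)`, then `exp (-φ)` is not integrable near `γ(t)`. -/
theorem not_locIntegrableOnGraphAt {y : ℝ → ℝ} {L : ℝ≥0} {a b : ℝ} (hab : a < b)
    (hy : LipschitzOnWith L y (Icc a b)) {t : ℝ} (ht : t ∈ Icc a b) {C : ℝ}
    (hC : ∀ ζ, ζ ≠ graphCurve y t → ‖ζ - graphCurve y t‖ < 1 →
      φ ζ ≤ ((C + Real.log ‖ζ - graphCurve y t‖ : ℝ) : EReal)) :
    ¬ LocIntegrableOnGraphAt y a b (fun z => EReal.exp (-φ z)) (graphCurve y t) := by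
  rintro ⟨V, hV, hlt⟩
  obtain ⟨ε, hε, hball⟩ := Metric.mem_nhds_iff.1 hV
  have hL : (0 : ℝ) < 1 + L := by positivity
  -- The graph between `t` and `u` then stays in `V` and in the unit disc about `γ(t)`. A one-sided
  -- interval suffices, so `t` may be an endpoint.
  obtain ⟨u, hu, hut, hη⟩ := exists_mem_Icc_ne_abs_lt hab ht
    (div_pos (lt_min hε one_pos) hL : 0 < min ε 1 / (1 + L))
  -- The constant `c` below comes from `e^{-φ} ≥ e^{-C} / d` and `d ≤ (1 + L) |s - t|`.
  have hsub : uIoc t u ⊆ Icc a b := uIoc_subset_uIcc.trans (uIcc_subset_Icc ht hu)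
  set c := Real.exp (-C) / (1 + L) with hc
  have hc0 : 0 < c := div_pos (Real.exp_pos _) hL
  have hpt : ∀ s ∈ uIoc t u, s ≠ t → ‖(s - t)⁻¹‖ₑ ≤ ENNReal.ofReal c⁻¹ *
      (V.indicator (fun z => EReal.exp (-φ z)) (graphCurve y s) *
        ENNReal.ofReal √(1 + (deriv y s) ^ 2)) := by
    intro s hs hst
    have hst' : |s - t| ≤ |u - t| := abs_sub_left_of_mem_uIcc (uIoc_subset_uIcc hs)
    set d := ‖graphCurve y s - graphCurve y t‖ with hd
    have hd1 : d ≤ (1 + L) * |s - t| := norm_graphCurve_sub_le hy (hsub hs) ht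
    have hd2 : |s - t| ≤ d := Complex.abs_re_le_norm (graphCurve y s - graphCurve y t)
    have hd0 : 0 < d := (abs_pos.2 (sub_ne_zero.2 hst)).trans_le hd2
    have hdmin : d < min ε 1 := by
      refine hd1.trans_lt ?_
      rw [lt_div_iff₀ hL] at hη
      calc (1 + L) * |s - t| ≤ (1 + L) * |u - t| := by gcongr
        _ < min ε 1 := by linarith
    have hmem : graphCurve y s ∈ V := hball (by
      rw [Metric.mem_ball, dist_eq_norm]; exact hdmin.trans_le (min_le_left _ _))
    have hφs := hC (graphCurve y s) (sub_ne_zero.1 (norm_pos_iff.1 hd0))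
      (hdmin.trans_le (min_le_right _ _))
    have h1 : ENNReal.ofReal (Real.exp (-(C + Real.log d))) ≤ EReal.exp (-φ (graphCurve y s)) := by
      rw [← EReal.exp_coe, EReal.coe_neg]
      exact EReal.exp_monotone (EReal.neg_le_neg_iff.2 hφs)
    have h2 : (1 : ℝ≥0∞) ≤ ENNReal.ofReal √(1 + (deriv y s) ^ 2) := by
      rw [ENNReal.one_le_ofReal, Real.one_le_sqrt]
      linarith [sq_nonneg (deriv y s)]
    have h3 : |s - t|⁻¹ ≤ c⁻¹ * Real.exp (-(C + Real.log d)) := by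
      rw [neg_add, Real.exp_add, Real.exp_neg (Real.log d), Real.exp_log hd0, hc, inv_div]
      have : (1 + L) / Real.exp (-C) * (Real.exp (-C) * d⁻¹) = (1 + L) * d⁻¹ := by
        field_simp
      rw [this, ← div_eq_mul_inv, le_div_iff₀ hd0, inv_mul_le_iff₀ (abs_pos.2 (sub_ne_zero.2 hst))]
      linarith
    rw [indicator_of_mem hmem, ← ofReal_norm, norm_inv, Real.norm_eq_abs]
    calc ENNReal.ofReal |s - t|⁻¹ ≤ ENNReal.ofReal (c⁻¹ * Real.exp (-(C + Real.log d))) :=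
          ENNReal.ofReal_le_ofReal h3
      _ = ENNReal.ofReal c⁻¹ * (ENNReal.ofReal (Real.exp (-(C + Real.log d))) * 1) := by
          rw [mul_one, ENNReal.ofReal_mul (by positivity)]
      _ ≤ _ := by gcongr
  have hint : IntegrableOn (fun s => (s - t)⁻¹) (uIoc t u) := by
    refine ⟨(by fun_prop : Measurable fun s : ℝ => (s - t)⁻¹).aestronglyMeasurable, ?_⟩
    rw [hasFiniteIntegral_iff_enorm]
    refine lt_of_le_of_lt ?_ (ENNReal.mul_lt_top (ENNReal.ofReal_lt_top (r := c⁻¹)) hlt)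
    rw [arcLintegral, ← lintegral_const_mul' _ _ ENNReal.ofReal_ne_top]
    refine le_trans (setLIntegral_mono_ae' measurableSet_uIoc ?_) (lintegral_mono_set hsub)
    have : ∀ᵐ s : ℝ, s ≠ t := by simp [ae_iff]
    filter_upwards [this] with s hst hs
    exact hpt s hs hst
  have := intervalIntegrable_sub_inv_iff.1 (intervalIntegrable_iff.2 hint)
  rcases this with h | h
  · exact hut h.symm
  · exact h left_mem_uIcc

end

/-! ### The main theorem -/

theorem mainTheorem5 (a b : ℝ) (hab : a < b) (y : ℝ → ℝ) (L : ℝ≥0)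
    (hy : LipschitzOnWith L y (Icc a b))
    (φ : ℂ → EReal) (hφ : IsSubharmonic φ) (hφ_ne : ∃ z, φ z ≠ ⊥)
    (t : ℝ) (ht : t ∈ Icc a b) :
    Tendsto (lelongQuotient φ (graphCurve y t)) (𝓝[>] (0 : ℝ))
        (𝓝 (lelongNumber φ (graphCurve y t))) ∧
      (lelongNumber φ (graphCurve y t) < 1 ↔
        LocIntegrableOnGraphAt y a b (fun z => EReal.exp (-φ z)) (graphCurve y t)) := by
  obtain ⟨G, U, h⟩ := hφ.exists_rieszApproximation hφ_ne
  obtain ⟨ν, hν0, hlim, ⟨C, hC⟩, hmass⟩ := h.exists_lelong hφ hφ_ne (graphCurve y t)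
  have hν : lelongNumber φ (graphCurve y t) = (ν : EReal) := hlim.limUnder_eq
  rw [hν, ← EReal.coe_one, EReal.coe_lt_coe_iff]
  refine ⟨hlim, fun hν1 => ?_, fun hloc => ?_⟩
  · obtain ⟨m, hm0, hm1⟩ := exists_between hν1
    obtain ⟨r, hr, hev⟩ := hmass m hm0
    exact h.locIntegrableOnGraphAt hφ hφ_ne hy (hν0.trans_lt hm0) hm1 hr hev
  · by_contra! hν1
    refine not_locIntegrableOnGraphAt hab hy ht (C := C) (fun ζ hζ hζ1 => ?_) hloc
    refine (hC ζ hζ hζ1).trans (EReal.coe_le_coe_iff.2 ?_)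
    -- The logarithm is nonpositive here, so replacing `ν ≥ 1` by `1` only increases the bound.
    have := mul_le_mul_of_nonpos_right hν1 (Real.log_nonpos (norm_nonneg _) hζ1.le)
    linarith
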